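/- Let $G$ be a locally compact (Hausdorff) group with a fixed left Haar measure, let $\lambda$ be its left regular representation on $L^2(G)$, $(\lambda(x)f)(y)=f(x^{-1}y)$, and let $VN(G)\subseteq \mathcal B(L^2(G))$ be the closure of $\operatorname{span}\{\lambda(x):x\in G\}$ in the weak operator topology. Let $$A(G)=\{\lambda_{f,g}: f,g\in L^2(G)\},\qquad \lambda_{f,g}(x)=\langle\lambda(x)f\,|\,g\rangle ,$$ be the Fourier algebra, with its operator space structure as the predual of $VN(G)$ under $\langle\lambda_{f,g},T\rangle=\langle Tf\,|\,g\rangle$. For $E\subseteq G$ let $I_G(E)=\{w\in A(G): w|_E=0\}$ and let $A_G(E)=\{w|_E:w\in A(G)\}$ carry the quotient operator space structure of $A(G)/I_G(E)$. The ideal $I_G(E)$ is called completely complemented in $A(G)$ if it is the range of a completely bounded linear map $P:A(G)\to A(G)$ with $P^2=P$. Let $H$ be a discrete subgroup of $G$, and let $E\subseteq H$ be a strong Leinert set in $H$: every bounded function on $E$, extended by zero to $H$, is a completely bounded multiplier of $A(H)$. 1. Let $U$ be an open neighbourhood of the identity $e$ such that the sets $gU$ ($g\in E$) are pairwise disjoint,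 let $V$ be a measurable relatively compact symmetric neighbourhood of $e$ with $V^2\subseteq U$, and let $u=\lambda_{\xi,\xi}$ with $\xi=1_V/\|1_V\|_2$. If $\delta_h*u*\delta_h=u$ for all $h\in E$, where $(\delta_h*u)(x)=u(h^{-1}x)$ and $(u*\delta_h)(x)=u(xh)$ (that is, if $u(h^{-1}xh)=u(x)$ for all $x\in G$, $h\in E$), then the formula $$\Gamma_u\varphi=\sum_{h\in E}\varphi(h)\,(\delta_h*u)$$ (pointwise convergent sum) defines a completely bounded linear map $\Gamma_u:A_G(E)\to A(G)$ with $(\Gamma_u\varphi)|_E=\varphi$ for all $\varphi\in A_G(E)$, and $I_G(E)$ is completely complemented in $A(G)$. 2. If $G$ is a $[SIN]$-group, i.e. if $e$ has a neighbourhood base of sets invariant under all inner automorphisms of $G$, then $I_G(E)$ is completely complemented in $A(G)$. -/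

import Mathlib

open MeasureTheory Topology
open scoped ENNReal NNReal Pointwise

noncomputable section

namespace LeinertFourier

/-! ### The left regular representation and the group von Neumann algebra -/

section Regular

variable {G : Type*} [Group G] [MeasurableSpace G] [MeasurableMul G]
variable (μ : Measure G) [μ.IsMulLeftInvariant]

/-- The left regular representation `(λ(x) f)(y) = f (x⁻¹ y)` on `L²(G, μ)`. -/
def leftReg (x : G) : Lp ℂ 2 μ →L[ℂ] Lp ℂ 2 μ :=
  (Lp.compMeasurePreservingₗᵢ ℂ (fun y : G => x⁻¹ * y)
    (measurePreserving_mul_left μ x⁻¹)).toContinuousLinearMap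

/-- The coefficient function `λ_{f,g}(x) = ⟨λ(x) f | g⟩`.  The scalar product `⟨· | ·⟩` is
conjugate-linear in the second variable, while Mathlib's `inner` is so in the first one. -/
def coeffFn (f g : Lp ℂ 2 μ) : G → ℂ := fun x => inner ℂ g (leftReg μ x f)

/-- The group von Neumann algebra `VN(G)`: the closure in the weak operator topology of the linear
span of `{λ(x) : x ∈ G}`, as a space of bounded operators on `L²(G)`. -/
def groupVN : Submodule ℂ (Lp ℂ 2 μ →L[ℂ] Lp ℂ 2 μ) :=
  ((Submodule.span ℂ (Set.range fun x : G =>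
      (ContinuousLinearMapWOT.ofCLM (leftReg μ x) : Lp ℂ 2 μ →WOT[ℂ] Lp ℂ 2 μ))).topologicalClosure).comap
    (ContinuousLinearMapWOT.linearEquiv (σ := RingHom.id ℂ) (E := Lp ℂ 2 μ) (F := Lp ℂ 2 μ)
      ℂ).symm.toLinearMap

theorem leftReg_mem_groupVN (x : G) : leftReg μ x ∈ groupVN μ :=
  Submodule.le_topologicalClosure _ (Submodule.subset_span ⟨x, rfl⟩)

/-- `λ(x)` as an element of `VN(G)`. -/
def leftRegVN (x : G) : groupVN μ := ⟨leftReg μ x, leftReg_mem_groupVN μ x⟩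

/-! ### The Fourier algebra and its duality with `VN(G)` -/

/-- The Fourier algebra `A(G)`, consisting of the functions `λ_{f,g}` with `f, g ∈ L²(G)`.
(The set of these functions is a linear space by a theorem of Eymard, hence equal to its
linear span; the span is taken here so that the linear structure is there by construction.) -/
def fourierAlgebra : Submodule ℂ (G → ℂ) :=
  Submodule.span ℂ (Set.range fun p : Lp ℂ 2 μ × Lp ℂ 2 μ => coeffFn μ p.1 p.2)

/-- The functional `T ↦ ⟨T f | g⟩` on `VN(G)`. -/
def vectorFunctional (f g : Lp ℂ 2 μ) : Module.Dual ℂ (groupVN μ) where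
  toFun T := inner ℂ g (T.1 f)
  map_add' S T := by simp [inner_add_right]
  map_smul' c T := by simp [inner_smul_right]

/-- The span of the functionals `T ↦ ⟨T f | g⟩` on `VN(G)`. -/
def vnPredual : Submodule ℂ (Module.Dual ℂ (groupVN μ)) :=
  Submodule.span ℂ (Set.range fun p : Lp ℂ 2 μ × Lp ℂ 2 μ => vectorFunctional μ p.1 p.2)

/-- A functional `ω` on `VN(G)` gives the function `x ↦ ω(λ(x))` on `G`. -/
def evalOnGroup : Module.Dual ℂ (groupVN μ) →ₗ[ℂ] (G → ℂ) where
  toFun ω x := ω (leftRegVN μ x)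
  map_add' _ _ := rfl
  map_smul' _ _ := rfl

theorem evalOnGroup_vectorFunctional (f g : Lp ℂ 2 μ) :
    evalOnGroup μ (vectorFunctional μ f g) = coeffFn μ f g := rfl

theorem map_vnPredual : (vnPredual μ).map (evalOnGroup μ) = fourierAlgebra μ := by
  rw [vnPredual, Submodule.map_span, fourierAlgebra, ← Set.range_comp]
  rfl

theorem exists_wot_extension {ω : Module.Dual ℂ (groupVN μ)} (hω : ω ∈ vnPredual μ) :
    ∃ Φ : (Lp ℂ 2 μ →WOT[ℂ] Lp ℂ 2 μ) →ₗ[ℂ] ℂ, Continuous Φ ∧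
      ∀ T : groupVN μ, ω T = Φ (ContinuousLinearMapWOT.ofCLM T.1) := by
  induction hω using Submodule.span_induction with
  | mem ω h =>
    obtain ⟨p, rfl⟩ := h
    refine ⟨{ toFun := fun T => inner ℂ p.2 (T p.1)
              map_add' := fun S T => by simp [inner_add_right]
              map_smul' := fun c T => by simp [inner_smul_right] }, ?_, fun T => rfl⟩
    exact ContinuousLinearMapWOT.continuous_dual_apply p.1 (innerSL ℂ p.2)
  | zero => exact ⟨0, continuous_const, fun T => rfl⟩
  | add ω₁ ω₂ _ _ h₁ h₂ =>
    obtain ⟨Φ₁, c₁, e₁⟩ := h₁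
    obtain ⟨Φ₂, c₂, e₂⟩ := h₂
    exact ⟨Φ₁ + Φ₂, c₁.add c₂, fun T => by simp [e₁, e₂]⟩
  | smul c ω _ h =>
    obtain ⟨Φ, hc, e⟩ := h
    exact ⟨c • Φ, hc.const_smul c, fun T => by simp [e]⟩

theorem evalOnGroup_injective :
    Function.Injective ((evalOnGroup μ).domRestrict (vnPredual μ)) := by
  rw [← LinearMap.ker_eq_bot, LinearMap.ker_eq_bot']
  rintro ⟨ω, hω⟩ h
  obtain ⟨Φ, hc, e⟩ := exists_wot_extension μ hω
  ext T
  have hclosed : IsClosed {S : Lp ℂ 2 μ →WOT[ℂ] Lp ℂ 2 μ | Φ S = 0} :=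
    isClosed_eq hc continuous_const
  have hle : Submodule.span ℂ (Set.range fun x : G =>
      (ContinuousLinearMapWOT.ofCLM (leftReg μ x) : Lp ℂ 2 μ →WOT[ℂ] Lp ℂ 2 μ)) ≤
      LinearMap.ker Φ := by
    rw [Submodule.span_le]
    rintro _ ⟨x, rfl⟩
    have hx := congrFun h x
    exact (e (leftRegVN μ x)).symm.trans hx
  have := Submodule.topologicalClosure_minimal _ hle hclosed T.2
  exact (e T).trans this

/-- `A(G)` is the predual of `VN(G)`: the function `λ_{f,g}` corresponds to `T ↦ ⟨T f | g⟩`. -/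
def predualEquiv : vnPredual μ ≃ₗ[ℂ] fourierAlgebra μ :=
  (LinearEquiv.ofInjective _ (evalOnGroup_injective μ)).trans
    (LinearEquiv.ofEq _ _ (by rw [LinearMap.range_domRestrict, map_vnPredual]))

/-- The duality `⟨w, T⟩` between `A(G)` and `VN(G)`. -/
def pairing (w : fourierAlgebra μ) (T : groupVN μ) : ℂ :=
  ((predualEquiv μ).symm w : Module.Dual ℂ (groupVN μ)) T

/-- The duality is the expected one: `⟨λ_{f,g}, T⟩ = ⟨T f | g⟩`. -/
theorem pairing_coeffFn (f g : Lp ℂ 2 μ) (h : coeffFn μ f g ∈ fourierAlgebra μ)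
    (T : groupVN μ) : pairing μ ⟨coeffFn μ f g, h⟩ T = inner ℂ g (T.1 f) := by
  have hv : vectorFunctional μ f g ∈ vnPredual μ := Submodule.subset_span ⟨(f, g), rfl⟩
  have : (predualEquiv μ).symm ⟨coeffFn μ f g, h⟩ = ⟨vectorFunctional μ f g, hv⟩ := by
    rw [LinearEquiv.symm_apply_eq]
    rfl
  rw [pairing, this]
  rfl

end Regular

/-! ### Operator space structures and complete boundedness -/

/-- The operator on the Hilbert space `H ⊕ ⋯ ⊕ H` given by an `m × m` matrix of operators on `H`. -/
def matrixOp {H : Type*} [NormedAddCommGroup H] [InnerProductSpace ℂ H] {m : ℕ}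
    (T : Matrix (Fin m) (Fin m) (H →L[ℂ] H)) :
    PiLp 2 (fun _ : Fin m => H) →L[ℂ] PiLp 2 (fun _ : Fin m => H) :=
  ((PiLp.continuousLinearEquiv 2 ℂ (fun _ : Fin m => H)).symm :
      (Fin m → H) →L[ℂ] PiLp 2 (fun _ : Fin m => H)).comp
    ((ContinuousLinearMap.pi fun k => ∑ l, (T k l).comp (ContinuousLinearMap.proj l)).comp
      ((PiLp.continuousLinearEquiv 2 ℂ (fun _ : Fin m => H)) :
        PiLp 2 (fun _ : Fin m => H) →L[ℂ] (Fin m → H)))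

/-- A linear map between spaces with matrix norms is completely bounded if its amplifications to
`n × n` matrices are bounded uniformly in `n`. -/
def IsCompletelyBounded {X Y : Type*} [AddCommGroup X] [Module ℂ X] [AddCommGroup Y] [Module ℂ Y]
    (normX : ∀ n : ℕ, Matrix (Fin n) (Fin n) X → ℝ≥0∞)
    (normY : ∀ n : ℕ, Matrix (Fin n) (Fin n) Y → ℝ≥0∞) (Φ : X →ₗ[ℂ] Y) : Prop :=
  ∃ C : ℝ≥0, ∀ (n : ℕ) (a : Matrix (Fin n) (Fin n) X), normY n (a.map Φ) ≤ C * normX n a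

section FourierOperatorSpace

variable {G : Type*} [Group G] [MeasurableSpace G] [MeasurableMul G]
variable (μ : Measure G) [μ.IsMulLeftInvariant]

/-- The norm of `M_n(A(G))` in the operator space structure of `A(G)` as the predual of `VN(G)`,
i.e. the completely bounded norm of `[w_ij]` as a map `VN(G) → M_n`: the supremum of
`‖[⟨w_ij, T_kl⟩]‖` over all `m` and all `[T_kl]` in the unit ball of
`M_m(VN(G)) ⊆ B(L²(G) ⊕ ⋯ ⊕ L²(G))`. -/
def fourierMatrixNorm (n : ℕ) (w : Matrix (Fin n) (Fin n) (fourierAlgebra μ)) : ℝ≥0∞ :=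
  ⨆ (m : ℕ) (T : Matrix (Fin m) (Fin m) (groupVN μ))
    (_ : ‖matrixOp (T.map fun t => (t : Lp ℂ 2 μ →L[ℂ] Lp ℂ 2 μ))‖ ≤ 1),
    ‖Matrix.toEuclideanCLM (n := Fin n × Fin m) (𝕜 := ℂ)
      (Matrix.of fun p q => pairing μ (w p.1 q.1) (T p.2 q.2))‖ₑ

/-- The restriction algebra `A_G(E) = {w|_E : w ∈ A(G)}`. -/
def restrictionAlgebra (E : Set G) : Submodule ℂ (E → ℂ) :=
  (fourierAlgebra μ).map (LinearMap.funLeft ℂ ℂ (Subtype.val : E → G))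

/-- The restriction map `A(G) → A_G(E)`. -/
def restrictTo (E : Set G) : fourierAlgebra μ →ₗ[ℂ] restrictionAlgebra μ E :=
  (LinearMap.funLeft ℂ ℂ (Subtype.val : E → G)).submoduleMap (fourierAlgebra μ)

/-- The norm of `M_n(A_G(E))`, for the quotient operator space structure
`A_G(E) = A(G) / I_G(E)`. -/
def restrictionMatrixNorm (E : Set G) (n : ℕ)
    (φ : Matrix (Fin n) (Fin n) (restrictionAlgebra μ E)) : ℝ≥0∞ :=
  ⨅ (w : Matrix (Fin n) (Fin n) (fourierAlgebra μ)) (_ : w.map (restrictTo μ E) = φ),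
    fourierMatrixNorm μ n w

/-- The ideal `I_G(E)` of the functions in `A(G)` that vanish on `E`. -/
def vanishingIdeal (E : Set G) : Submodule ℂ (fourierAlgebra μ) where
  carrier := {w | ∀ x ∈ E, (w : G → ℂ) x = 0}
  zero_mem' := fun _ _ => rfl
  add_mem' := fun {a b} ha hb x hx => by simp [ha x hx, hb x hx]
  smul_mem' := fun c a ha x hx => by simp [ha x hx]

/-- A subspace `I` of `A(G)` is completely complemented if it is the range of a completely bounded
linear projection `P : A(G) → A(G)`. -/
def IsCompletelyComplemented (I : Submodule ℂ (fourierAlgebra μ)) : Prop :=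
  ∃ P : fourierAlgebra μ →ₗ[ℂ] fourierAlgebra μ,
    IsCompletelyBounded (fourierMatrixNorm μ) (fourierMatrixNorm μ) P ∧
      P ∘ₗ P = P ∧ LinearMap.range P = I

/-- `v` belongs to `M_cb A(G)`: the map `w ↦ v w` sends `A(G)` into itself and is completely
bounded. -/
def IsCBMultiplier (v : G → ℂ) : Prop :=
  ∃ M : fourierAlgebra μ →ₗ[ℂ] fourierAlgebra μ,
    (∀ (w : fourierAlgebra μ) (x : G), (M w : G → ℂ) x = v x * (w : G → ℂ) x) ∧
      IsCompletelyBounded (fourierMatrixNorm μ) (fourierMatrixNorm μ) M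

end FourierOperatorSpace

/-- A subset `F` of a discrete group `D` is a strong Leinert set if every bounded function on `F`,
extended by zero to `D`, belongs to `M_cb A(D)`.  The Haar measure of `D` is the counting
measure. -/
def IsStrongLeinertSet {D : Type*} [Group D] [TopologicalSpace D] [IsTopologicalGroup D]
    [DiscreteTopology D] [MeasurableSpace D] [BorelSpace D] (F : Set D) : Prop :=
  ∀ v : D → ℂ, (∃ C : ℝ, ∀ x, ‖v x‖ ≤ C) → (∀ x ∉ F, v x = 0) →
    IsCBMultiplier (Measure.count : Measure D) v

/-! ### The bump function, translations, `[SIN]`-groups -/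

section Bump

variable {G : Type*} [Group G] [TopologicalSpace G] [MeasurableSpace G]

/-- `V` is a (measurable, relatively compact) symmetric neighbourhood of the identity such that
`V V` lies in an open neighbourhood `U` of the identity whose translates `g U`, `g ∈ E`, are
pairwise disjoint. -/
structure IsBumpNhd (E V : Set G) : Prop where
  mem_nhds : V ∈ 𝓝 (1 : G)
  measurableSet : MeasurableSet V
  isCompact_closure : IsCompact (closure V)
  symmetric : V⁻¹ = V
  separating : ∃ U : Set G, IsOpen U ∧ (1 : G) ∈ U ∧ V * V ⊆ U ∧
    ∀ g₁ ∈ E, ∀ g₂ ∈ E, g₁ ≠ g₂ → Disjoint (g₁ • U) (g₂ • U)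

variable (μ : Measure G) [IsFiniteMeasureOnCompacts μ]

theorem IsBumpNhd.measure_ne_top {E V : Set G} (hV : IsBumpNhd E V) : μ V ≠ ∞ :=
  ((measure_mono subset_closure).trans_lt hV.isCompact_closure.measure_lt_top).ne

/-- The unit vector `ξ = 1_V / ‖1_V‖₂` of `L²(G)`. -/
def bumpVector {E V : Set G} (hV : IsBumpNhd E V) : Lp ℂ 2 μ :=
  ((‖indicatorConstLp 2 hV.measurableSet (hV.measure_ne_top μ) (1 : ℂ)‖⁻¹ : ℝ) : ℂ) •
    indicatorConstLp 2 hV.measurableSet (hV.measure_ne_top μ) (1 : ℂ)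

/-- The bump function `u(x) = ⟨λ(x) ξ | ξ⟩`, where `ξ = 1_V / ‖1_V‖₂`. -/
def bumpFn [MeasurableMul G] [μ.IsMulLeftInvariant] {E V : Set G} (hV : IsBumpNhd E V) : G → ℂ :=
  coeffFn μ (bumpVector μ hV) (bumpVector μ hV)

end Bump

/-- `(δ_h * u)(x) = u (h⁻¹ x)`. -/
def deltaConv {G : Type*} [Group G] (h : G) (u : G → ℂ) : G → ℂ := fun x => u (h⁻¹ * x)

/-- `(u * δ_h)(x) = u (x h)`. -/
def convDelta {G : Type*} [Group G] (u : G → ℂ) (h : G) : G → ℂ := fun x => u (x * h)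

/-- `Γ` is the extension map `Γ_u φ = ∑_{h ∈ E} φ(h) (δ_h * u)` from `A_G(E)` to `A(G)`. -/
def IsExtensionMap {G : Type*} [Group G] [MeasurableSpace G] [MeasurableMul G]
    (μ : Measure G) [μ.IsMulLeftInvariant] (E : Set G) (u : G → ℂ)
    (Γ : restrictionAlgebra μ E →ₗ[ℂ] fourierAlgebra μ) : Prop :=
  (∀ (φ : restrictionAlgebra μ E) (x : G),
    HasSum (fun h : E => (φ : E → ℂ) h * deltaConv (h : G) u x) ((Γ φ : G → ℂ) x)) ∧
  ∀ (φ : restrictionAlgebra μ E) (h : E), (Γ φ : G → ℂ) h = (φ : E → ℂ) h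

/-- `G` is a `[SIN]`-group: the identity has a neighbourhood base of sets that are invariant under
all inner automorphisms. -/
def IsSINGroup (G : Type*) [Group G] [TopologicalSpace G] : Prop :=
  ∀ U ∈ 𝓝 (1 : G), ∃ W ∈ 𝓝 (1 : G), W ⊆ U ∧ ∀ g : G, ∀ w ∈ W, g * w * g⁻¹ ∈ W

end LeinertFourier

end

open LeinertFourier

noncomputable section

/-! Let D be the subgroup of H generated by E and let v be the indicator function of E. The
extension operator comes from a composition Φ of four completely bounded maps: A(G) → A(H)
(restriction), A(H) → A(H) (multiplication by v, completely bounded by the strong Leinert property),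
A(H) → A(D) (restriction), and A(D) → A(G), w ↦ ∑_t w(t) (δ_t * u). Then Φ w = ∑_{h ∈ E} w(h) (δ_h *
u) depends only on w|_E, and it agrees with w on E because u(e) = 1 and u(h⁻¹g) = 0 for distinct h,
g in E. So Φ factors through A_G(E), which gives Γ_u, and id - Φ is a projection onto I_G(E).

The last map (`exists_extensionHom`) is the preadjoint of T ↦ J† T J, where J sends δ_h to λ(h)ξ.
Schur's test bounds J, as u has finite support along D. Conjugation invariance of u turns J† λ(x) J
into the finite sum ∑_t u(t⁻¹x) λ(t), an element of VN(D). Invariance under E gives invariance under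
D only, hence the passage from H to D.

Restriction (`isCompletelyBounded_restrictHom`) is the preadjoint of VN(D) → VN(G), λ(h) ↦ λ(h). To
build that map, every f in L²(G) is written as Bζ with B : ℓ²(D) → L²(G) intertwining the two
actions (`exists_intertwiner`), and T is made to act by Bζ ↦ B T ζ. The products B†B' commute with
VN(D), which yields the matrix norm bound (`sum_norm_sq_le_matrixOp`).

For a [SIN]-group, V is chosen invariant under conjugation. Right translations by G then preserve
μ(V), hence μ, so u is conjugation invariant and the first part applies. -/

namespace LeinertFourier

/-! ### Hilbert space tools: absolute values and polar decomposition. -/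

section Hilbert

variable {X Y : Type*} [NormedAddCommGroup X] [InnerProductSpace ℂ X] [CompleteSpace X]
  [NormedAddCommGroup Y] [InnerProductSpace ℂ Y] [CompleteSpace Y]

open ContinuousLinearMap in
/-- The absolute value `(B† B)^{1/2}` of a bounded operator `B`. -/
theorem exists_operator_abs (B : X →L[ℂ] Y) :
    ∃ S : X →L[ℂ] X, IsSelfAdjoint S ∧ (∀ x, ‖S x‖ = ‖B x‖) ∧
      ∀ A : X →L[ℂ] X, Commute (adjoint B ∘L B) A → Commute S A := by
  have hpos : (0 : X →L[ℂ] X) ≤ adjoint B ∘L B :=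
    (nonneg_iff_isPositive _).2 (isPositive_adjoint_comp_self B)
  have hsa : IsSelfAdjoint (CFC.sqrt (adjoint B ∘L B)) :=
    IsSelfAdjoint.of_nonneg (CFC.sqrt_nonneg _)
  refine ⟨CFC.sqrt (adjoint B ∘L B), hsa, fun x => ?_, fun A hA => ?_⟩
  · have hsq : CFC.sqrt (adjoint B ∘L B) * CFC.sqrt (adjoint B ∘L B) = adjoint B ∘L B :=
      CFC.sqrt_mul_sqrt_self _ hpos
    have h1 : inner ℂ (CFC.sqrt (adjoint B ∘L B) x) (CFC.sqrt (adjoint B ∘L B) x) =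
        inner ℂ (B x) (B x) := by
      rw [← adjoint_inner_left, ← adjoint_inner_left, ← star_eq_adjoint, hsa.star_eq]
      change inner ℂ ((CFC.sqrt (adjoint B ∘L B) * CFC.sqrt (adjoint B ∘L B)) x) x = _
      rw [hsq]
      rfl
    rw [inner_self_eq_norm_sq_to_K, inner_self_eq_norm_sq_to_K] at h1
    exact (sq_eq_sq₀ (norm_nonneg _) (norm_nonneg _)).1 (by exact_mod_cast h1)
  · exact hA.cfcₙ_nnreal _

open ContinuousLinearMap in
/-- The isometric part of the polar decomposition of the adjoint of an injective operator `i`,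
with its equivariance. -/
theorem exists_isometry_of_injective (i : X →L[ℂ] Y) (hi : Function.Injective i) :
    ∃ W : X →ₗᵢ[ℂ] Y, ∀ (A : X →L[ℂ] X) (A' : Y →L[ℂ] Y), i ∘L A = A' ∘L i →
      i ∘L adjoint A = adjoint A' ∘L i → ∀ x, W (A x) = A' (W x) := by
  obtain ⟨S, hS, hn, hc⟩ := exists_operator_abs i
  have hSinj : Function.Injective S := by
    refine (injective_iff_map_eq_zero S).2 fun x hx => ?_
    have := hn x
    rw [hx, norm_zero, eq_comm, norm_eq_zero] at this
    exact (injective_iff_map_eq_zero i).1 hi x this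
  have hdense : Dense (LinearMap.range (S : X →ₗ[ℂ] X) : Set X) := by
    rw [Submodule.dense_iff_topologicalClosure_eq_top, Submodule.topologicalClosure_eq_top_iff,
      Submodule.eq_bot_iff]
    intro x hx
    rw [Submodule.mem_orthogonal] at hx
    apply (injective_iff_map_eq_zero S).1 hSinj x
    have := hx (S (S x)) ⟨S x, rfl⟩
    rw [← adjoint_inner_right, ← star_eq_adjoint, hS.star_eq] at this
    exact inner_self_eq_zero.1 this
  let e := LinearEquiv.ofInjective (S : X →ₗ[ℂ] X) hSinj
  -- On the dense range of S = |i| the map S x ↦ i x is isometric, since ‖S x‖ = ‖i x‖; W is its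
  -- continuous extension.
  let W₀ : LinearMap.range (S : X →ₗ[ℂ] X) →ₗᵢ[ℂ] Y :=
    { toLinearMap := (i : X →ₗ[ℂ] Y) ∘ₗ e.symm.toLinearMap
      norm_map' := fun y => by
        obtain ⟨x, rfl⟩ := e.surjective y
        simpa [e] using (hn x).symm }
  have hui : IsUniformInducing (LinearMap.range (S : X →ₗ[ℂ] X)).subtypeL :=
    isUniformEmbedding_subtype_val.isUniformInducing
  have hdr : DenseRange (LinearMap.range (S : X →ₗ[ℂ] X)).subtypeL := by
    rw [DenseRange, show Set.range (LinearMap.range (S : X →ₗ[ℂ] X)).subtypeL =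
      (LinearMap.range (S : X →ₗ[ℂ] X) : Set X) from Subtype.range_coe]
    exact hdense
  let W₁ : X →L[ℂ] Y := W₀.toContinuousLinearMap.extend (LinearMap.range (S : X →ₗ[ℂ] X)).subtypeL
  have hW₁ : ∀ x, W₁ (S x) = i x := fun x => by
    have := W₀.toContinuousLinearMap.extend_eq hdr hui (e x)
    refine Eq.trans this ?_
    simp [W₀]
  have hd2 : DenseRange S := hdense
  have hnW : ∀ x, ‖W₁ x‖ = ‖x‖ := fun x =>
    hd2.induction_on x (isClosed_eq (by fun_prop) (by fun_prop)) fun y => by rw [hW₁, hn]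
  refine ⟨⟨W₁, hnW⟩, fun A A' h h' x => ?_⟩
  change W₁ (A x) = A' (W₁ x)
  -- The relation for adjoints gives i† A' = A i†, so i† i A = i† A' i = A i† i; hence A commutes
  -- with S as well.
  have hcomm : Commute (adjoint i ∘L i) A := by
    have h2 : adjoint i ∘L A' = A ∘L adjoint i := by
      have := congrArg adjoint h'
      simpa [adjoint_comp] using this.symm
    change (adjoint i ∘L i) ∘L A = A ∘L (adjoint i ∘L i)
    rw [comp_assoc, h, ← comp_assoc, h2, comp_assoc]
  have hSA := hc A hcomm
  refine hd2.induction_on x (isClosed_eq (by fun_prop) (by fun_prop)) fun y => ?_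
  have h3 : A (S y) = S (A y) := (congrArg (fun T : X →L[ℂ] X => T y) hSA.eq).symm
  rw [h3, hW₁, hW₁]
  exact congrArg (fun T : X →L[ℂ] Y => T y) h

end Hilbert

/-- Schur's test: vectors whose Gram matrix has uniformly bounded row sums are the image of a
Hilbert basis under a bounded operator. -/
theorem exists_operator_of_gram {X Y ι : Type*} [NormedAddCommGroup X] [InnerProductSpace ℂ X]
    [NormedAddCommGroup Y] [InnerProductSpace ℂ Y] [CompleteSpace Y]
    (b : HilbertBasis ι ℂ X) (v : ι → Y) (C : ℝ)
    (hC : ∀ h, ∀ s : Finset ι, ∑ k ∈ s, ‖inner ℂ (v h) (v k)‖ ≤ C) :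
    ∃ J : X →L[ℂ] Y, ∀ h, J (b h) = v h := by
  classical
  have key : ∀ (a : ι → ℂ) (s : Finset ι), ‖∑ h ∈ s, a h • v h‖ ^ 2 ≤ C * ∑ h ∈ s, ‖a h‖ ^ 2 := by
    intro a s
    have h1 : ‖∑ h ∈ s, a h • v h‖ ^ 2 ≤
        ∑ h ∈ s, ∑ k ∈ s, ‖a h‖ * ‖a k‖ * ‖inner ℂ (v h) (v k)‖ := by
      have : (‖∑ h ∈ s, a h • v h‖ ^ 2 : ℝ) = ‖inner ℂ (∑ h ∈ s, a h • v h) (∑ h ∈ s, a h • v h)‖ := by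
        rw [inner_self_eq_norm_sq_to_K (𝕜 := ℂ)]
        simp
      rw [this, sum_inner]
      refine (norm_sum_le _ _).trans (Finset.sum_le_sum fun h _ => ?_)
      rw [inner_sum]
      refine (norm_sum_le _ _).trans (Finset.sum_le_sum fun k _ => ?_)
      rw [inner_smul_left, inner_smul_right, norm_mul, norm_mul, mul_assoc]
      simp
    -- By |a_h||a_k| ≤ (|a_h|² + |a_k|²)/2 and the symmetry of the absolute Gram matrix, bounded row
    -- sums suffice.
    have h2 : ∑ h ∈ s, ∑ k ∈ s, ‖a h‖ * ‖a k‖ * ‖inner ℂ (v h) (v k)‖ ≤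
        ∑ h ∈ s, ∑ k ∈ s, (‖a h‖ ^ 2 / 2 * ‖inner ℂ (v h) (v k)‖ +
          ‖a k‖ ^ 2 / 2 * ‖inner ℂ (v k) (v h)‖) := by
      refine Finset.sum_le_sum fun h _ => Finset.sum_le_sum fun k _ => ?_
      rw [norm_inner_symm (v k) (v h), ← add_mul]
      refine mul_le_mul_of_nonneg_right ?_ (norm_nonneg _)
      nlinarith [sq_nonneg (‖a h‖ - ‖a k‖)]
    have h3 : ∑ h ∈ s, ∑ k ∈ s, ‖a h‖ ^ 2 / 2 * ‖inner ℂ (v h) (v k)‖ ≤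
        C / 2 * ∑ h ∈ s, ‖a h‖ ^ 2 := by
      rw [Finset.mul_sum]
      refine Finset.sum_le_sum fun h _ => ?_
      rw [← Finset.mul_sum]
      nlinarith [hC h s, sq_nonneg ‖a h‖]
    have h4 : ∑ h ∈ s, ∑ k ∈ s, (‖a h‖ ^ 2 / 2 * ‖inner ℂ (v h) (v k)‖ +
          ‖a k‖ ^ 2 / 2 * ‖inner ℂ (v k) (v h)‖) =
        ∑ h ∈ s, ∑ k ∈ s, ‖a h‖ ^ 2 / 2 * ‖inner ℂ (v h) (v k)‖ +
        ∑ h ∈ s, ∑ k ∈ s, ‖a h‖ ^ 2 / 2 * ‖inner ℂ (v h) (v k)‖ := by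
      simp only [Finset.sum_add_distrib]
      congr 1
      exact Finset.sum_comm
    linarith
  have hsq : ∀ x : X, Summable fun h => ‖b.repr x h‖ ^ 2 := fun x => by
    simpa using (lp.memℓp (b.repr x)).summable (by norm_num)
  have hC0 : ∀ h : ι, 0 ≤ C := fun h => by simpa using hC h ∅
  have hsum : ∀ x : X, Summable fun h => b.repr x h • v h := by
    intro x
    rw [summable_iff_vanishing_norm]
    intro ε hε
    obtain ⟨s, hs⟩ := summable_iff_vanishing_norm.1 (hsq x) (ε ^ 2 / (|C| + 1)) (by positivity)
    refine ⟨s, fun t ht => ?_⟩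
    have h1 := hs t ht
    rw [Real.norm_of_nonneg (by positivity), lt_div_iff₀ (by positivity)] at h1
    have h2 := key (fun h => b.repr x h) t
    have h3 : (0 : ℝ) ≤ ∑ h ∈ t, ‖b.repr x h‖ ^ 2 := by positivity
    refine lt_of_pow_lt_pow_left₀ 2 hε.le (lt_of_le_of_lt h2 ?_)
    nlinarith [le_abs_self C]
  let L : X →ₗ[ℂ] Y :=
    { toFun := fun x => ∑' h, b.repr x h • v h
      map_add' := fun x y => by
        rw [← (hsum x).tsum_add (hsum y)]
        simp [add_smul]
      map_smul' := fun c x => by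
        rw [RingHom.id_apply, ← (hsum x).tsum_const_smul c]
        simp [mul_smul] }
  have hbound : ∀ x, ‖L x‖ ≤ √|C| * ‖x‖ := by
    intro x
    have hx : ‖L x‖ ^ 2 ≤ |C| * ‖x‖ ^ 2 := by
      refine le_of_tendsto ((hsum x).hasSum.norm.pow 2) (Filter.Eventually.of_forall fun s => ?_)
      refine (key _ s).trans ?_
      have h5 : ∑ h ∈ s, ‖b.repr x h‖ ^ 2 ≤ ‖x‖ ^ 2 := by
        simpa [b.repr_apply_apply] using b.orthonormal.sum_inner_products_le (s := s) x
      have h3 : (0 : ℝ) ≤ ∑ h ∈ s, ‖b.repr x h‖ ^ 2 := by positivity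
      nlinarith [le_abs_self C, abs_nonneg C]
    rw [← sq_le_sq₀ (norm_nonneg _) (by positivity), mul_pow, Real.sq_sqrt (abs_nonneg _)]
    exact hx
  refine ⟨L.mkContinuous _ hbound, fun h => ?_⟩
  change ∑' k, b.repr (b h) k • v k = v h
  rw [tsum_eq_single h fun k hk => by simp [b.repr_self, hk]]
  simp [b.repr_self]

/-! ### The left regular representation is unitary. -/

section LeftRegular

variable {G : Type*} [Group G] [MeasurableSpace G] [MeasurableMul G]
variable (μ : Measure G) [μ.IsMulLeftInvariant]

theorem coeFn_leftReg (x : G) (f : Lp ℂ 2 μ) :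
    leftReg μ x f =ᵐ[μ] fun y => f (x⁻¹ * y) :=
  Lp.coeFn_compMeasurePreserving f (measurePreserving_mul_left μ x⁻¹)

theorem leftReg_one_apply (f : Lp ℂ 2 μ) : leftReg μ 1 f = f := by
  refine Lp.ext ((coeFn_leftReg μ 1 f).trans ?_)
  simp

theorem leftReg_mul_apply (x y : G) (f : Lp ℂ 2 μ) :
    leftReg μ (x * y) f = leftReg μ x (leftReg μ y f) := by
  refine Lp.ext ((coeFn_leftReg μ _ f).trans ?_)
  refine Filter.EventuallyEq.trans ?_ (coeFn_leftReg μ x _).symm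
  have := (measurePreserving_mul_left μ x⁻¹).quasiMeasurePreserving.ae_eq_comp
    (coeFn_leftReg μ y f)
  filter_upwards [this] with z hz
  simpa [mul_assoc] using hz.symm

theorem inner_leftReg_leftReg (x : G) (f g : Lp ℂ 2 μ) :
    inner ℂ (leftReg μ x f) (leftReg μ x g) = inner ℂ f g :=
  (Lp.compMeasurePreservingₗᵢ ℂ (fun y : G => x⁻¹ * y)
    (measurePreserving_mul_left μ x⁻¹)).inner_map_map f g

theorem inner_leftReg_left (x : G) (f g : Lp ℂ 2 μ) :
    inner ℂ (leftReg μ x f) g = inner ℂ f (leftReg μ x⁻¹ g) := by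
  rw [← inner_leftReg_leftReg μ x⁻¹ (leftReg μ x f) g, ← leftReg_mul_apply, inv_mul_cancel,
    leftReg_one_apply]

theorem adjoint_leftReg (x : G) :
    ContinuousLinearMap.adjoint (leftReg μ x) = leftReg μ x⁻¹ := by
  symm
  rw [ContinuousLinearMap.eq_adjoint_iff]
  intro f g
  rw [inner_leftReg_left, inv_inv]

end LeftRegular

/-! ### The standard basis of ℓ²(D). -/

section Discrete

variable {D : Type*} [MeasurableSpace D] [DiscreteMeasurableSpace D]

/-- The unit vector `δ_h` of `ℓ²(D)`. -/
def delta (h : D) : Lp ℂ 2 (Measure.count : Measure D) :=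
  indicatorConstLp 2 (MeasurableSet.of_discrete (s := {h})) (by simp) 1

theorem delta_apply (h x : D) : delta h x = Set.indicator {h} (fun _ => (1 : ℂ)) x :=
  Measure.ae_count_iff.1 (indicatorConstLp_coeFn (hs := MeasurableSet.of_discrete (s := {h}))) x

theorem inner_delta_left (h : D) (f : Lp ℂ 2 (Measure.count : Measure D)) :
    inner ℂ (delta h) f = f h := by
  rw [delta, L2.inner_indicatorConstLp_one]
  simp

theorem leftReg_delta [Group D] (k h : D) : leftReg Measure.count k (delta h) = delta (k * h) := by
  classical
  refine Lp.ext (Measure.ae_count_iff.2 fun x => ?_)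
  refine (Measure.ae_count_iff.1 (coeFn_leftReg _ k (delta h)) x).trans ?_
  change delta h (k⁻¹ * x) = _
  rw [delta_apply, delta_apply]
  simp [Set.indicator_apply, inv_mul_eq_iff_eq_mul]

theorem orthonormal_delta : Orthonormal ℂ (delta : D → _) := by
  classical
  rw [orthonormal_iff_ite]
  intro h k
  rw [inner_delta_left, delta_apply]
  simp [Set.indicator_apply]

theorem orthogonal_span_delta : (Submodule.span ℂ (Set.range (delta : D → _)))ᗮ = ⊥ := by
  rw [Submodule.eq_bot_iff]
  intro f hf
  rw [Submodule.mem_orthogonal] at hf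
  refine Lp.ext (Measure.ae_count_iff.2 fun x => ?_)
  rw [← inner_delta_left, hf _ (Submodule.subset_span ⟨x, rfl⟩)]
  exact (Measure.ae_count_iff.1 (Lp.coeFn_zero ℂ 2 (Measure.count : Measure D)) x).symm

variable (D) in
/-- The Hilbert basis `(δ_h)` of `ℓ²(D)`. -/
def deltaBasis : HilbertBasis D ℂ (Lp ℂ 2 (Measure.count : Measure D)) :=
  HilbertBasis.mkOfOrthogonalEqBot orthonormal_delta orthogonal_span_delta

@[simp]
theorem deltaBasis_apply (h : D) : deltaBasis D h = delta h := by
  simp [deltaBasis]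

theorem dense_span_delta : Dense (SetLike.coe (Submodule.span ℂ (Set.range (delta : D → _)))) := by
  rw [Submodule.dense_iff_topologicalClosure_eq_top, Submodule.topologicalClosure_eq_top_iff]
  exact orthogonal_span_delta

theorem clm_ext_delta {Y : Type*} [NormedAddCommGroup Y] [NormedSpace ℂ Y]
    {A B : Lp ℂ 2 (Measure.count : Measure D) →L[ℂ] Y} (h : ∀ x, A (delta x) = B (delta x)) :
    A = B := by
  refine ContinuousLinearMap.ext_on dense_span_delta ?_
  rintro _ ⟨x, rfl⟩
  exact h x

end Discrete

/-! ### The duality between A(G) and VN(G), and commutants. -/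

section Duality

variable {G : Type*} [Group G] [MeasurableSpace G] [MeasurableMul G]
variable (μ : Measure G) [μ.IsMulLeftInvariant]

/-- `λ_{f,g}` as an element of `A(G)`. -/
def coeffElt (f g : Lp ℂ 2 μ) : fourierAlgebra μ :=
  ⟨coeffFn μ f g, Submodule.subset_span ⟨(f, g), rfl⟩⟩

@[simp]
theorem pairing_coeffElt (f g : Lp ℂ 2 μ) (T : groupVN μ) :
    pairing μ (coeffElt μ f g) T = inner ℂ g (T.1 f) :=
  pairing_coeffFn μ f g _ T

theorem coeffElt_add_left (f f' g : Lp ℂ 2 μ) :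
    coeffElt μ (f + f') g = coeffElt μ f g + coeffElt μ f' g :=
  Subtype.ext (funext fun x => by simp [coeffElt, coeffFn, inner_add_right])

theorem coeffElt_smul_left (c : ℂ) (f g : Lp ℂ 2 μ) :
    coeffElt μ (c • f) g = c • coeffElt μ f g :=
  Subtype.ext (funext fun x => by simp [coeffElt, coeffFn, inner_smul_right])

theorem span_coeffElt :
    Submodule.span ℂ (Set.range fun p : Lp ℂ 2 μ × Lp ℂ 2 μ => coeffElt μ p.1 p.2) = ⊤ := by
  have h := Submodule.span_span_coe_preimage (R := ℂ)
    (s := Set.range fun p : Lp ℂ 2 μ × Lp ℂ 2 μ => coeffFn μ p.1 p.2)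
  refine Eq.trans ?_ h
  congr 1
  ext w
  exact ⟨fun ⟨p, hp⟩ => ⟨p, congrArg Subtype.val hp⟩, fun ⟨p, hp⟩ => ⟨p, Subtype.ext hp⟩⟩

/-- Linear maps on `A(G)` are determined by their values on the functions `λ_{f,g}`. -/
theorem fourierAlgebra_hom_ext {M : Type*} [AddCommMonoid M] [Module ℂ M]
    {Φ Ψ : fourierAlgebra μ →ₗ[ℂ] M}
    (h : ∀ f g, Φ (coeffElt μ f g) = Ψ (coeffElt μ f g)) : Φ = Ψ := by
  refine LinearMap.ext_on_range (span_coeffElt μ) fun p => h p.1 p.2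

/-- The pairing with `T ∈ VN(G)` as a linear form on `A(G)`. -/
def pairingLeft (T : groupVN μ) : fourierAlgebra μ →ₗ[ℂ] ℂ :=
  LinearMap.applyₗ T ∘ₗ (vnPredual μ).subtype ∘ₗ (predualEquiv μ).symm.toLinearMap

theorem pairingLeft_apply (T : groupVN μ) (w : fourierAlgebra μ) :
    pairingLeft μ T w = pairing μ w T := rfl

theorem pairing_smul_right (c : ℂ) (w : fourierAlgebra μ) (T : groupVN μ) :
    pairing μ w (c • T) = c * pairing μ w T :=
  map_smul _ c T

theorem pairing_sub_left (w w' : fourierAlgebra μ) (T : groupVN μ) :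
    pairing μ (w - w') T = pairing μ w T - pairing μ w' T :=
  map_sub (pairingLeft μ T) w w'

theorem pairing_leftRegVN (w : fourierAlgebra μ) (x : G) :
    pairing μ w (leftRegVN μ x) = (w : G → ℂ) x := by
  let ev : fourierAlgebra μ →ₗ[ℂ] ℂ := LinearMap.proj x ∘ₗ (fourierAlgebra μ).subtype
  have : pairingLeft μ (leftRegVN μ x) = ev :=
    fourierAlgebra_hom_ext μ fun f g => pairing_coeffElt μ f g _
  exact LinearMap.congr_fun this w

/-- An operator that commutes with the left regular representation commutes with `VN(G)`. -/
theorem comp_eq_comp_of_mem_groupVN {T : Lp ℂ 2 μ →L[ℂ] Lp ℂ 2 μ} (hT : T ∈ groupVN μ)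
    {A : Lp ℂ 2 μ →L[ℂ] Lp ℂ 2 μ} (hA : ∀ x, A ∘L leftReg μ x = leftReg μ x ∘L A) :
    A ∘L T = T ∘L A := by
  refine ContinuousLinearMap.ext fun f => ext_inner_left ℂ fun g => ?_
  -- L(S) = ⟨g, (AS - SA)f⟩ is continuous in the weak operator topology and kills every λ(x), so it
  -- vanishes on VN(G).
  let L : (Lp ℂ 2 μ →WOT[ℂ] Lp ℂ 2 μ) →ₗ[ℂ] ℂ :=
    { toFun := fun S => inner ℂ (ContinuousLinearMap.adjoint A g) (S f) - inner ℂ g (S (A f))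
      map_add' := fun S S' => by simp [inner_add_right]; ring
      map_smul' := fun c S => by simp [inner_smul_right]; ring }
  have hL : Continuous L :=
    (ContinuousLinearMapWOT.continuous_dual_apply f (innerSL ℂ (ContinuousLinearMap.adjoint A g))).sub
      (ContinuousLinearMapWOT.continuous_dual_apply (A f) (innerSL ℂ g))
  have hle : Submodule.span ℂ (Set.range fun x : G =>
      (ContinuousLinearMapWOT.ofCLM (leftReg μ x) : Lp ℂ 2 μ →WOT[ℂ] Lp ℂ 2 μ)) ≤
      LinearMap.ker L := by
    rw [Submodule.span_le]
    rintro _ ⟨x, rfl⟩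
    have h1 := congrArg (fun S : Lp ℂ 2 μ →L[ℂ] Lp ℂ 2 μ => inner ℂ g (S f)) (hA x)
    simp only [ContinuousLinearMap.comp_apply] at h1
    change inner ℂ (ContinuousLinearMap.adjoint A g) (leftReg μ x f) -
      inner ℂ g (leftReg μ x (A f)) = 0
    rw [ContinuousLinearMap.adjoint_inner_left, h1, sub_self]
  have h0 := Submodule.topologicalClosure_minimal _ hle
    (isClosed_eq hL continuous_const : IsClosed {S | L S = 0}) hT
  have h2 : inner ℂ (ContinuousLinearMap.adjoint A g) (T f) - inner ℂ g (T (A f)) = 0 := h0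
  rw [ContinuousLinearMap.adjoint_inner_left, sub_eq_zero] at h2
  exact h2

end Duality

/-! ### Complete boundedness through adjoints. -/

section CompletelyBounded

theorem IsCompletelyBounded.comp {X Y Z : Type*} [AddCommGroup X] [Module ℂ X] [AddCommGroup Y]
    [Module ℂ Y] [AddCommGroup Z] [Module ℂ Z]
    {nX : ∀ n : ℕ, Matrix (Fin n) (Fin n) X → ℝ≥0∞}
    {nY : ∀ n : ℕ, Matrix (Fin n) (Fin n) Y → ℝ≥0∞}
    {nZ : ∀ n : ℕ, Matrix (Fin n) (Fin n) Z → ℝ≥0∞} {Ψ : Y →ₗ[ℂ] Z} {Φ : X →ₗ[ℂ] Y}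
    (hΨ : IsCompletelyBounded nY nZ Ψ) (hΦ : IsCompletelyBounded nX nY Φ) :
    IsCompletelyBounded nX nZ (Ψ ∘ₗ Φ) := by
  obtain ⟨C, hC⟩ := hΨ
  obtain ⟨C', hC'⟩ := hΦ
  refine ⟨C * C', fun n a => ?_⟩
  have h1 := hC n (a.map Φ)
  rw [Matrix.map_map] at h1
  refine h1.trans ?_
  rw [ENNReal.coe_mul, mul_assoc]
  gcongr
  exact hC' n a

variable {G₁ G₂ : Type*} [Group G₁] [MeasurableSpace G₁] [MeasurableMul G₁]
  [Group G₂] [MeasurableSpace G₂] [MeasurableMul G₂]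
  (μ₁ : Measure G₁) [μ₁.IsMulLeftInvariant] (μ₂ : Measure G₂) [μ₂.IsMulLeftInvariant]

/-- The matrix of operators underlying a matrix over `VN(G)`. -/
def vnMatrixOp {m : ℕ} (T : Matrix (Fin m) (Fin m) (groupVN μ₁)) :
    PiLp 2 (fun _ : Fin m => Lp ℂ 2 μ₁) →L[ℂ] PiLp 2 (fun _ : Fin m => Lp ℂ 2 μ₁) :=
  matrixOp (T.map fun t => (t : Lp ℂ 2 μ₁ →L[ℂ] Lp ℂ 2 μ₁))

@[simp]
theorem matrixOp_apply {H : Type*} [NormedAddCommGroup H] [InnerProductSpace ℂ H] {m : ℕ}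
    (T : Matrix (Fin m) (Fin m) (H →L[ℂ] H)) (f : PiLp 2 (fun _ : Fin m => H)) (k : Fin m) :
    matrixOp T f k = ∑ l, T k l (f l) := by
  simp [matrixOp]

theorem matrixOp_smul {H : Type*} [NormedAddCommGroup H] [InnerProductSpace ℂ H] {m : ℕ} (c : ℂ)
    (T : Matrix (Fin m) (Fin m) (H →L[ℂ] H)) : matrixOp (c • T) = c • matrixOp T := by
  ext f k
  simp [Finset.smul_sum]

/-- A map between Fourier algebras with a completely bounded adjoint is completely bounded. -/
theorem isCompletelyBounded_of_adjoint (Φ : fourierAlgebra μ₁ →ₗ[ℂ] fourierAlgebra μ₂)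
    (Ψ : groupVN μ₂ → groupVN μ₁) (h : ∀ w T, pairing μ₂ (Φ w) T = pairing μ₁ w (Ψ T))
    (C : ℝ≥0) (hC : ∀ (m : ℕ) (T : Matrix (Fin m) (Fin m) (groupVN μ₂)),
      ‖vnMatrixOp μ₁ (T.map Ψ)‖ ≤ C * ‖vnMatrixOp μ₂ T‖) :
    IsCompletelyBounded (fourierMatrixNorm μ₁) (fourierMatrixNorm μ₂) Φ := by
  -- With C + 1 in place of C the scalar is nonzero, so Ψ(T) can be rescaled into the unit ball.
  refine ⟨C + 1, fun n w => ?_⟩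
  refine iSup_le fun m => iSup_le fun T => iSup_le fun hT => ?_
  set c : ℂ := ((C + 1 : ℝ) : ℂ) with hc
  have hcn : ‖c‖ = C + 1 := by
    rw [hc, Complex.norm_real, Real.norm_of_nonneg (by positivity)]
  have hc0 : c ≠ 0 := by
    rw [← norm_ne_zero_iff, hcn]
    positivity
  set T' : Matrix (Fin m) (Fin m) (groupVN μ₁) := c⁻¹ • T.map Ψ with hT'
  have hT'n : ‖vnMatrixOp μ₁ T'‖ ≤ 1 := by
    have h1 : vnMatrixOp μ₁ T' = c⁻¹ • vnMatrixOp μ₁ (T.map Ψ) := by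
      rw [vnMatrixOp, vnMatrixOp, ← matrixOp_smul]
      rfl
    rw [h1, norm_smul, norm_inv, hcn, inv_mul_le_iff₀ (by positivity), mul_one]
    refine (hC m T).trans ?_
    have : ‖vnMatrixOp μ₂ T‖ ≤ 1 := hT
    nlinarith [C.2]
  have h2 : Matrix.toEuclideanCLM (n := Fin n × Fin m) (𝕜 := ℂ)
      (Matrix.of fun p q => pairing μ₂ (w.map Φ p.1 q.1) (T p.2 q.2)) =
      c • Matrix.toEuclideanCLM (n := Fin n × Fin m) (𝕜 := ℂ)
      (Matrix.of fun p q => pairing μ₁ (w p.1 q.1) (T' p.2 q.2)) := by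
    rw [← map_smul]
    congr 1
    ext p q
    simp [hT', h, pairing_smul_right, hc0]
  rw [h2, enorm_smul]
  have h3 : ‖c‖ₑ = ((C + 1 : ℝ≥0) : ℝ≥0∞) := by
    rw [← ofReal_norm, hcn, ← ENNReal.ofReal_coe_nnreal, NNReal.coe_add, NNReal.coe_one]
  rw [h3]
  gcongr
  exact le_iSup_of_le m (le_iSup_of_le T' (le_iSup_of_le hT'n le_rfl))

theorem fourierMatrixNorm_sub_le (n : ℕ) (a b : Matrix (Fin n) (Fin n) (fourierAlgebra μ₁)) :
    fourierMatrixNorm μ₁ n (a - b) ≤ fourierMatrixNorm μ₁ n a + fourierMatrixNorm μ₁ n b := by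
  refine iSup_le fun m => iSup_le fun T => iSup_le fun hT => ?_
  have h2 : Matrix.toEuclideanCLM (n := Fin n × Fin m) (𝕜 := ℂ)
      (Matrix.of fun p q => pairing μ₁ ((a - b) p.1 q.1) (T p.2 q.2)) =
      Matrix.toEuclideanCLM (n := Fin n × Fin m) (𝕜 := ℂ)
        (Matrix.of fun p q => pairing μ₁ (a p.1 q.1) (T p.2 q.2)) -
      Matrix.toEuclideanCLM (n := Fin n × Fin m) (𝕜 := ℂ)
        (Matrix.of fun p q => pairing μ₁ (b p.1 q.1) (T p.2 q.2)) := by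
    rw [← map_sub]
    congr 1
    ext p q
    simp [pairing_sub_left]
  rw [h2]
  refine enorm_sub_le.trans (add_le_add ?_ ?_)
  · exact le_iSup_of_le m (le_iSup_of_le T (le_iSup_of_le hT le_rfl))
  · exact le_iSup_of_le m (le_iSup_of_le T (le_iSup_of_le hT le_rfl))

theorem isCompletelyBounded_id_sub {Φ : fourierAlgebra μ₁ →ₗ[ℂ] fourierAlgebra μ₁}
    (hΦ : IsCompletelyBounded (fourierMatrixNorm μ₁) (fourierMatrixNorm μ₁) Φ) :
    IsCompletelyBounded (fourierMatrixNorm μ₁) (fourierMatrixNorm μ₁) (LinearMap.id - Φ) := by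
  obtain ⟨C, hC⟩ := hΦ
  refine ⟨1 + C, fun n a => ?_⟩
  have h1 : a.map (LinearMap.id - Φ : fourierAlgebra μ₁ →ₗ[ℂ] fourierAlgebra μ₁) = a - a.map Φ := rfl
  rw [h1, ENNReal.coe_add, add_mul, ENNReal.coe_one, one_mul]
  refine (fourierMatrixNorm_sub_le μ₁ n _ _).trans ?_
  gcongr
  exact hC n a

end CompletelyBounded

/-! ### Every vector of L²(G) lies in the range of an intertwiner from ℓ²(D). -/

section Factorization

variable {D G : Type*} [Group D] [MeasurableSpace D] [DiscreteMeasurableSpace D]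
  [Group G] [MeasurableSpace G] [MeasurableMul G]
variable (μ : Measure G) [μ.IsMulLeftInvariant] (j : D →* G)

/-- A vector `g ∈ L²(G)` is bounded for `j : D → G` if `δ_h ↦ λ(j h) g` extends to a bounded
operator `ℓ²(D) → L²(G)`. -/
def IsBoundedVector (g : Lp ℂ 2 μ) : Prop :=
  ∃ J : Lp ℂ 2 (Measure.count : Measure D) →L[ℂ] Lp ℂ 2 μ, ∀ h, J (delta h) = leftReg μ (j h) g

/-- A bounded operator `ℓ²(D) → L²(G)` is an intertwiner if it carries the left regular
representation of `D` to the restriction of that of `G`. -/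
def IsIntertwiner (B : Lp ℂ 2 (Measure.count : Measure D) →L[ℂ] Lp ℂ 2 μ) : Prop :=
  ∀ h x, B (leftReg Measure.count h x) = leftReg μ (j h) (B x)

/-- The closed invariant subspace of `ℓ²(D) ⊕ L²(G)` generated by `(δ_1, f)`. -/
def cyclicSubspace (f : Lp ℂ 2 μ) :
    Submodule ℂ (WithLp 2 (Lp ℂ 2 (Measure.count : Measure D) × Lp ℂ 2 μ)) :=
  (Submodule.span ℂ (Set.range fun h : D =>
    WithLp.toLp 2 (delta h, leftReg μ (j h) f))).topologicalClosure

/-- The diagonal action of `D` on `ℓ²(D) ⊕ L²(G)`. -/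
def diagReg (h : D) : WithLp 2 (Lp ℂ 2 (Measure.count : Measure D) × Lp ℂ 2 μ) →L[ℂ]
    WithLp 2 (Lp ℂ 2 (Measure.count : Measure D) × Lp ℂ 2 μ) :=
  (WithLp.prodContinuousLinearEquiv 2 ℂ _ _).symm.toContinuousLinearMap ∘L
    ((leftReg Measure.count h).prodMap (leftReg μ (j h))) ∘L
      (WithLp.prodContinuousLinearEquiv 2 ℂ _ _).toContinuousLinearMap

theorem inner_diagReg_left (h : D)
    (z z' : WithLp 2 (Lp ℂ 2 (Measure.count : Measure D) × Lp ℂ 2 μ)) :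
    inner ℂ (diagReg μ j h z) z' = inner ℂ z (diagReg μ j h⁻¹ z') := by
  rw [WithLp.prod_inner_apply, WithLp.prod_inner_apply]
  change inner ℂ (leftReg _ h z.fst) z'.fst + inner ℂ (leftReg μ (j h) z.snd) z'.snd =
    inner ℂ z.fst (leftReg _ h⁻¹ z'.fst) + inner ℂ z.snd (leftReg μ (j h⁻¹) z'.snd)
  rw [inner_leftReg_left, inner_leftReg_left, map_inv]

theorem diagReg_mem_cyclicSubspace (f : Lp ℂ 2 μ) (h : D) :
    ∀ z ∈ cyclicSubspace μ j f, diagReg μ j h z ∈ cyclicSubspace μ j f := by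
  intro z hz
  have hmaps : Set.MapsTo (diagReg μ j h)
      (Submodule.span ℂ (Set.range fun h : D => WithLp.toLp 2 (delta h, leftReg μ (j h) f)))
      (Submodule.span ℂ (Set.range fun h : D => WithLp.toLp 2 (delta h, leftReg μ (j h) f))) := by
    intro y hy
    suffices hle : Submodule.span ℂ
        (Set.range fun h : D => WithLp.toLp 2 (delta h, leftReg μ (j h) f)) ≤
        Submodule.comap (diagReg μ j h).toLinearMap (Submodule.span ℂ
          (Set.range fun h : D => WithLp.toLp 2 (delta h, leftReg μ (j h) f))) from hle hy
    rw [Submodule.span_le]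
    rintro _ ⟨k, rfl⟩
    refine Submodule.subset_span ⟨h * k, ?_⟩
    change _ = WithLp.toLp 2 (leftReg _ h (delta k), leftReg μ (j h) (leftReg μ (j k) f))
    rw [leftReg_delta, ← leftReg_mul_apply, ← map_mul]
  exact map_mem_closure (diagReg μ j h).continuous hz hmaps

/-- This says that δ_h ↦ λ(h)f is closable. For a bounded vector g the numbers ⟨g, λ(h)f⟩ are square
summable over h, so they are given by pairing δ_h with some c in ℓ²(D). The relation ⟨g, y⟩ = ⟨c, x⟩
then passes from the generators to every (x, y) in the cyclic subspace, and x = 0 forces y ⊥ g.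
Bounded vectors g are dense. -/
theorem eq_zero_of_fst_eq_zero (hd : Dense {g | IsBoundedVector μ j g}) {f : Lp ℂ 2 μ}
    {z : WithLp 2 (Lp ℂ 2 (Measure.count : Measure D) × Lp ℂ 2 μ)}
    (hz : z ∈ cyclicSubspace μ j f) (h0 : z.fst = 0) : z = 0 := by
  have key : ∀ g, IsBoundedVector μ j g → inner ℂ g z.snd = 0 := by
    rintro g ⟨J, hJ⟩
    -- Bessel's inequality for J†f; the inverse of h appears because ⟨g, λ(h)f⟩ = ⟨λ(h⁻¹)g, f⟩.
    have hmem : Memℓp (fun h : D => (starRingEnd ℂ) (inner ℂ (J (delta h⁻¹)) f)) 2 := by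
      refine memℓp_gen ?_
      have h1 := (orthonormal_delta (D := D)).inner_products_summable
        (ContinuousLinearMap.adjoint J f)
      have h2 := (Equiv.inv D).summable_iff.2 h1
      refine h2.congr fun h => ?_
      simp [ContinuousLinearMap.adjoint_inner_right, norm_inner_symm f]
    set c := (deltaBasis D).repr.symm ⟨_, hmem⟩ with hc
    have hcin : ∀ h, inner ℂ c (delta h) = inner ℂ (J (delta h⁻¹)) f := by
      intro h
      rw [← inner_conj_symm, ← deltaBasis_apply, ← HilbertBasis.repr_apply_apply, hc,
        LinearIsometryEquiv.apply_symm_apply]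
      simp
    let L : WithLp 2 (Lp ℂ 2 (Measure.count : Measure D) × Lp ℂ 2 μ) →L[ℂ] ℂ :=
      innerSL ℂ g ∘L WithLp.sndL 2 ℂ _ _ - innerSL ℂ c ∘L WithLp.fstL 2 ℂ _ _
    have hle : cyclicSubspace μ j f ≤ LinearMap.ker L.toLinearMap := by
      refine Submodule.topologicalClosure_minimal _ ?_ L.isClosed_ker
      rw [Submodule.span_le]
      rintro _ ⟨h, rfl⟩
      change inner ℂ g (leftReg μ (j h) f) - inner ℂ c (delta h) = 0
      rw [hcin, hJ, inner_leftReg_left, map_inv, inv_inv, sub_self]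
    have hLz : inner ℂ g z.snd - inner ℂ c z.fst = 0 := hle hz
    rwa [h0, inner_zero_right, sub_zero] at hLz
  have h2 : z.snd = 0 := hd.eq_zero_of_inner_right ℂ fun g hg => key g hg
  exact (WithLp.ofLp_injective 2) (Prod.ext h0 h2)

/-- Every vector of `L²(G)` is the image of a vector of `ℓ²(D)` under an intertwiner. -/
theorem exists_intertwiner (hd : Dense {g | IsBoundedVector μ j g}) (f : Lp ℂ 2 μ) :
    ∃ (B : Lp ℂ 2 (Measure.count : Measure D) →L[ℂ] Lp ℂ 2 μ)
      (ζ : Lp ℂ 2 (Measure.count : Measure D)), IsIntertwiner μ j B ∧ B ζ = f := by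
  let Q := cyclicSubspace μ j f
  have : CompleteSpace Q := (Submodule.isClosed_topologicalClosure _).completeSpace_coe
  let i : Q →L[ℂ] Lp ℂ 2 (Measure.count : Measure D) := WithLp.fstL 2 ℂ _ _ ∘L Q.subtypeL
  have hi : Function.Injective i := by
    refine (injective_iff_map_eq_zero i).2 fun z hz => ?_
    exact Subtype.ext (eq_zero_of_fst_eq_zero μ j hd z.2 hz)
  obtain ⟨W, hW⟩ := exists_isometry_of_injective i hi
  let A : D → Q →L[ℂ] Q := fun h => (diagReg μ j h).restrict (diagReg_mem_cyclicSubspace μ j f h)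
  have hAadj : ∀ h, ContinuousLinearMap.adjoint (A h) = A h⁻¹ := by
    intro h
    symm
    rw [ContinuousLinearMap.eq_adjoint_iff]
    intro x y
    have := inner_diagReg_left μ j h⁻¹ x.1 y.1
    rw [inv_inv] at this
    exact this
  have hiA : ∀ h, i ∘L A h = leftReg Measure.count h ∘L i := fun h => rfl
  have hWA : ∀ h x, W (A h x) = leftReg Measure.count h (W x) := fun h =>
    hW (A h) _ (hiA h) (by rw [hAadj, adjoint_leftReg]; exact hiA h⁻¹)
  -- V = W† is an equivariant left inverse of W, so B = snd ∘ V sends ζ = W(δ_1, f) back to the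
  -- second coordinate f.
  let V := ContinuousLinearMap.adjoint W.toContinuousLinearMap
  have hVW : ∀ x, V (W x) = x := fun x => by
    refine ext_inner_left ℂ fun y => ?_
    rw [ContinuousLinearMap.adjoint_inner_right]
    exact W.inner_map_map y x
  have hVA : ∀ h x, V (leftReg Measure.count h x) = A h (V x) := fun h x => by
    refine ext_inner_left ℂ fun y => ?_
    rw [ContinuousLinearMap.adjoint_inner_right, ← ContinuousLinearMap.adjoint_inner_left,
      adjoint_leftReg, ← ContinuousLinearMap.adjoint_inner_left, hAadj,
      ContinuousLinearMap.adjoint_inner_right]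
    exact congrArg (fun t => inner ℂ t x) (hWA h⁻¹ y).symm
  let q : Q := ⟨WithLp.toLp 2 (delta 1, leftReg μ (j 1) f),
    Submodule.le_topologicalClosure _ (Submodule.subset_span ⟨1, rfl⟩)⟩
  refine ⟨WithLp.sndL 2 ℂ _ _ ∘L Q.subtypeL ∘L V, W q, fun h x => ?_, ?_⟩
  · simp only [ContinuousLinearMap.comp_apply, hVA]
    rfl
  · simp only [ContinuousLinearMap.comp_apply, hVW]
    change leftReg μ (j 1) f = f
    rw [map_one, leftReg_one_apply]

end Factorization

/-- The norm estimate behind the amplification of a normal homomorphism: the operators `T k l`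
commute with `B_p† B_q`. -/
theorem sum_norm_sq_le_matrixOp {X Y : Type*} [NormedAddCommGroup X] [InnerProductSpace ℂ X]
    [CompleteSpace X] [NormedAddCommGroup Y] [InnerProductSpace ℂ Y] [CompleteSpace Y] {m : ℕ}
    (B : Fin m → X →L[ℂ] Y) (T : Matrix (Fin m) (Fin m) (X →L[ℂ] X))
    (hT : ∀ p q k l, (ContinuousLinearMap.adjoint (B p) ∘L B q) ∘L T k l =
      T k l ∘L (ContinuousLinearMap.adjoint (B p) ∘L B q)) (ζ : Fin m → X) :
    ∑ k, ‖∑ l, B l (T k l (ζ l))‖ ^ 2 ≤ ‖matrixOp T‖ ^ 2 * ∑ l, ‖B l (ζ l)‖ ^ 2 := by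
  classical
  -- R is the row operator (B_1, …, B_m) and S = |R|. The entries of R†R are the B_p†B_q, so each
  -- diag(T_kl) commutes with R†R and hence with S. This allows R to be replaced by S in all norms.
  let R : PiLp 2 (fun _ : Fin m => X) →L[ℂ] Y :=
    ∑ l, B l ∘L PiLp.proj 2 (fun _ : Fin m => X) l
  have hR : ∀ x, R x = ∑ l, B l (x l) := fun x => by simp [R]
  obtain ⟨S, -, hn, hc⟩ := exists_operator_abs R
  let dg : (X →L[ℂ] X) → PiLp 2 (fun _ : Fin m => X) →L[ℂ] PiLp 2 (fun _ : Fin m => X) :=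
    fun A => matrixOp (Matrix.diagonal fun _ => A)
  have hdg : ∀ A x p, dg A x p = A (x p) := fun A x p => by
    simp only [dg, matrixOp_apply]
    rw [Finset.sum_eq_single p (fun q _ hq => by simp [Matrix.diagonal_apply_ne' _ hq])
      (by simp)]
    simp
  have hdc : ∀ k l x, S (dg (T k l) x) = dg (T k l) (S x) := by
    intro k l x
    refine congrArg (fun U : PiLp 2 (fun _ : Fin m => X) →L[ℂ] PiLp 2 (fun _ : Fin m => X) => U x)
      (hc (dg (T k l)) ?_).eq
    refine ContinuousLinearMap.ext fun x => ?_
    have hRR : ∀ y p, (ContinuousLinearMap.adjoint R (R y)) p =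
        ∑ q, ContinuousLinearMap.adjoint (B p) (B q (y q)) := by
      intro y p
      refine ext_inner_left ℂ fun v => ?_
      have h1 : inner ℂ (PiLp.single 2 p v : PiLp 2 (fun _ : Fin m => X))
          (ContinuousLinearMap.adjoint R (R y)) =
          inner ℂ v ((ContinuousLinearMap.adjoint R (R y)) p) := by
        rw [PiLp.inner_apply, Finset.sum_eq_single p]
        · simp
        · intro q _ hq
          simp [hq]
        · simp
      have h2 : R (PiLp.single 2 p v : PiLp 2 (fun _ : Fin m => X)) = B p v := by
        rw [hR, Finset.sum_eq_single p]
        · simp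
        · intro q _ hq
          simp [hq]
        · simp
      rw [← h1, ContinuousLinearMap.adjoint_inner_right, h2, hR, ← map_sum,
        ContinuousLinearMap.adjoint_inner_right]
    ext p
    change (ContinuousLinearMap.adjoint R (R (dg (T k l) x))) p =
      (dg (T k l) (ContinuousLinearMap.adjoint R (R x))) p
    rw [hdg, hRR, hRR, map_sum]
    refine Finset.sum_congr rfl fun q _ => ?_
    rw [hdg]
    exact congrArg (fun U : X →L[ℂ] X => U (x q)) (hT p q k l)
  let η : Fin m → PiLp 2 (fun _ : Fin m => X) := fun l => S (PiLp.single 2 l (ζ l))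
  have hη : ∀ l, ‖η l‖ = ‖B l (ζ l)‖ := by
    intro l
    rw [hn, hR, Finset.sum_eq_single l]
    · simp
    · intro q _ hq
      simp [hq]
    · simp
  have h1 : ∀ k, ‖∑ l, B l (T k l (ζ l))‖ = ‖∑ l, dg (T k l) (η l)‖ := by
    intro k
    have h2 : ∑ l, B l (T k l (ζ l)) = R (∑ l, dg (T k l) (PiLp.single 2 l (ζ l))) := by
      rw [map_sum]
      refine Finset.sum_congr rfl fun l _ => ?_
      rw [hR, Finset.sum_eq_single l]
      · simp [hdg]
      · intro q _ hq
        simp [hdg, hq]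
      · simp
    rw [h2, ← hn, map_sum]
    simp only [hdc, η]
  -- The vectors η_l live in a direct sum of copies of X on which each T_kl acts diagonally, so the
  -- norm of the matrix T applies in each coordinate p separately.
  have h3 : ∀ p, ∑ k, ‖∑ l, T k l (η l p)‖ ^ 2 ≤ ‖matrixOp T‖ ^ 2 * ∑ l, ‖η l p‖ ^ 2 := by
    intro p
    have h4 := (matrixOp T).le_opNorm (WithLp.toLp 2 fun l => η l p)
    have h5 := pow_le_pow_left₀ (norm_nonneg _) h4 2
    rw [mul_pow, PiLp.norm_sq_eq_of_L2, PiLp.norm_sq_eq_of_L2] at h5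
    simpa using h5
  calc ∑ k, ‖∑ l, B l (T k l (ζ l))‖ ^ 2 = ∑ k, ∑ p, ‖∑ l, T k l (η l p)‖ ^ 2 := by
        refine Finset.sum_congr rfl fun k _ => ?_
        rw [h1, PiLp.norm_sq_eq_of_L2]
        refine Finset.sum_congr rfl fun p _ => ?_
        congr 2
        simp [hdg]
    _ = ∑ p, ∑ k, ‖∑ l, T k l (η l p)‖ ^ 2 := Finset.sum_comm
    _ ≤ ∑ p, ‖matrixOp T‖ ^ 2 * ∑ l, ‖η l p‖ ^ 2 := Finset.sum_le_sum fun p _ => h3 p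
    _ = ‖matrixOp T‖ ^ 2 * ∑ l, ‖η l‖ ^ 2 := by
        rw [← Finset.mul_sum, Finset.sum_comm]
        congr 1
        exact Finset.sum_congr rfl fun l _ => (PiLp.norm_sq_eq_of_L2 _ _).symm
    _ = _ := by simp only [hη]

/-! ### Complete boundedness of restriction A(G) → A(D). -/

section Restriction

variable {D G : Type*} [Group D] [MeasurableSpace D] [DiscreteMeasurableSpace D]
  [Group G] [MeasurableSpace G] [MeasurableMul G]
variable {μ : Measure G} [μ.IsMulLeftInvariant] {j : D →* G}

open ContinuousLinearMap in
theorem IsIntertwiner.adjoint_apply {B : Lp ℂ 2 (Measure.count : Measure D) →L[ℂ] Lp ℂ 2 μ}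
    (hB : IsIntertwiner μ j B) (h : D) (y : Lp ℂ 2 μ) :
    adjoint B (leftReg μ (j h) y) = leftReg Measure.count h (adjoint B y) := by
  refine ext_inner_right ℂ fun x => ?_
  rw [adjoint_inner_left, inner_leftReg_left, inner_leftReg_left, adjoint_inner_left, hB, map_inv]

-- Both B' and B† intertwine, so B†B' commutes with λ(D), and therefore with its weak operator
-- closed span.
open ContinuousLinearMap in
theorem IsIntertwiner.adjoint_comp_commute
    {B B' : Lp ℂ 2 (Measure.count : Measure D) →L[ℂ] Lp ℂ 2 μ}
    (hB : IsIntertwiner μ j B) (hB' : IsIntertwiner μ j B')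
    (T : groupVN (Measure.count : Measure D)) :
    (adjoint B ∘L B') ∘L T.1 = T.1 ∘L (adjoint B ∘L B') :=
  comp_eq_comp_of_mem_groupVN _ T.2 fun h => ContinuousLinearMap.ext fun x => by
    simp [hB' h, hB.adjoint_apply h]

theorem IsIntertwiner.coeffFn_comp {B : Lp ℂ 2 (Measure.count : Measure D) →L[ℂ] Lp ℂ 2 μ}
    (hB : IsIntertwiner μ j B) (ζ : Lp ℂ 2 (Measure.count : Measure D)) (g : Lp ℂ 2 μ) :
    coeffFn μ (B ζ) g ∘ j =
      coeffFn Measure.count ζ (ContinuousLinearMap.adjoint B g) := by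
  funext h
  simp [coeffFn, ContinuousLinearMap.adjoint_inner_left, hB h]

/-- With f = Bζ for an intertwiner B, the coefficient λ_{f,g} restricts to λ_{ζ,B†g}. -/
theorem comp_mem_fourierAlgebra (hd : Dense {g | IsBoundedVector μ j g}) :
    ∀ w ∈ fourierAlgebra μ, LinearMap.funLeft ℂ ℂ j w ∈
      fourierAlgebra (Measure.count : Measure D) := by
  intro w hw
  suffices h : fourierAlgebra μ ≤ (fourierAlgebra (Measure.count : Measure D)).comap
      (LinearMap.funLeft ℂ ℂ j) from h hw
  refine Submodule.span_le.2 ?_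
  rintro _ ⟨⟨f, g⟩, rfl⟩
  obtain ⟨B, ζ, hB, rfl⟩ := exists_intertwiner μ j hd f
  exact Submodule.subset_span ⟨(ζ, ContinuousLinearMap.adjoint B g), (hB.coeffFn_comp ζ g).symm⟩

/-- The restriction map `A(G) → A(D)` along `j : D → G`. -/
def restrictHom (hd : Dense {g | IsBoundedVector μ j g}) :
    fourierAlgebra μ →ₗ[ℂ] fourierAlgebra (Measure.count : Measure D) :=
  (LinearMap.funLeft ℂ ℂ j).restrict (comp_mem_fourierAlgebra hd)

theorem restrictHom_apply (hd : Dense {g | IsBoundedVector μ j g}) (w : fourierAlgebra μ) (h : D) :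
    (restrictHom hd w : D → ℂ) h = (w : G → ℂ) (j h) := rfl

theorem restrictHom_coeffElt (hd : Dense {g | IsBoundedVector μ j g})
    {B : Lp ℂ 2 (Measure.count : Measure D) →L[ℂ] Lp ℂ 2 μ}
    (hB : IsIntertwiner μ j B) (ζ : Lp ℂ 2 (Measure.count : Measure D)) (g : Lp ℂ 2 μ) :
    restrictHom hd (coeffElt μ (B ζ) g) =
      coeffElt Measure.count ζ (ContinuousLinearMap.adjoint B g) :=
  Subtype.ext (hB.coeffFn_comp ζ g)

theorem sum_norm_sq_intertwiner_le {m : ℕ}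
    {B : Fin m → Lp ℂ 2 (Measure.count : Measure D) →L[ℂ] Lp ℂ 2 μ}
    (hB : ∀ l, IsIntertwiner μ j (B l))
    (T : Matrix (Fin m) (Fin m) (groupVN (Measure.count : Measure D)))
    (ζ : Fin m → Lp ℂ 2 (Measure.count : Measure D)) :
    ∑ k, ‖∑ l, B l ((T k l).1 (ζ l))‖ ^ 2 ≤
      ‖vnMatrixOp Measure.count T‖ ^ 2 * ∑ l, ‖B l (ζ l)‖ ^ 2 :=
  sum_norm_sq_le_matrixOp B (T.map fun t => t.1)
    (fun p q k l => (hB p).adjoint_comp_commute (hB q) (T k l)) ζ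

/-- If `T' f` is weakly given by the pairing of `T` with restricted coefficients, then `T'`
extends `T` along intertwiners. -/
theorem apply_intertwiner_of_pairing (hd : Dense {g | IsBoundedVector μ j g})
    (T : groupVN (Measure.count : Measure D)) {T' : Lp ℂ 2 μ → Lp ℂ 2 μ}
    (hT' : ∀ f g, inner ℂ g (T' f) = pairing Measure.count (restrictHom hd (coeffElt μ f g)) T)
    {B : Lp ℂ 2 (Measure.count : Measure D) →L[ℂ] Lp ℂ 2 μ} (hB : IsIntertwiner μ j B)
    (ζ : Lp ℂ 2 (Measure.count : Measure D)) : T' (B ζ) = B (T.1 ζ) := by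
  refine ext_inner_left ℂ fun g => ?_
  rw [hT', restrictHom_coeffElt hd hB, pairing_coeffElt, ContinuousLinearMap.adjoint_inner_left]

/-- T' is defined by Bζ ↦ B T ζ for a chosen factorization of each f. The weak description by the
pairing does not see the choice, which is why T' is linear; the matrix estimate with m = 1 makes it
bounded. -/
theorem exists_operator_lift (hd : Dense {g | IsBoundedVector μ j g})
    (T : groupVN (Measure.count : Measure D)) :
    ∃ T' : Lp ℂ 2 μ →L[ℂ] Lp ℂ 2 μ, ∀ f g,
      inner ℂ g (T' f) = pairing Measure.count (restrictHom hd (coeffElt μ f g)) T := by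
  choose B ζ hB hf using exists_intertwiner μ j hd
  have hin : ∀ f g, inner ℂ g (B f (T.1 (ζ f))) =
      pairing Measure.count (restrictHom hd (coeffElt μ f g)) T := by
    intro f g
    conv_rhs => rw [← hf f]
    rw [restrictHom_coeffElt hd (hB f), pairing_coeffElt, ContinuousLinearMap.adjoint_inner_left]
  let L : Lp ℂ 2 μ →ₗ[ℂ] Lp ℂ 2 μ :=
    { toFun := fun f => B f (T.1 (ζ f))
      map_add' := fun f f' => ext_inner_left ℂ fun g => by
        rw [inner_add_right, hin, hin, hin, coeffElt_add_left, map_add, ← pairingLeft_apply,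
          map_add, pairingLeft_apply, pairingLeft_apply]
      map_smul' := fun c f => ext_inner_left ℂ fun g => by
        rw [RingHom.id_apply, inner_smul_right, hin, hin, coeffElt_smul_left, map_smul,
          ← pairingLeft_apply, map_smul, pairingLeft_apply, smul_eq_mul] }
  refine ⟨L.mkContinuous ‖vnMatrixOp (m := 1) Measure.count fun _ _ => T‖ fun f => ?_, hin⟩
  have h1 := sum_norm_sq_intertwiner_le (m := 1) (fun _ => hB f) (fun _ _ => T) (fun _ => ζ f)
  simp only [Finset.univ_unique, Finset.sum_singleton, hf, ← mul_pow] at h1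
  exact (sq_le_sq₀ (norm_nonneg _) (by positivity)).1 h1

/-- Finite combinations of the λ(h) approximating T in VN(D) have counterparts in VN(G) with the
same coefficients. On f = Bζ these act through B, so ⟨· f, g⟩ becomes ⟨· ζ, B†g⟩ and weak
convergence to T carries over to weak convergence to T'. No norm bound on the approximants is
needed. -/
theorem lift_mem_groupVN (hd : Dense {g | IsBoundedVector μ j g})
    (T : groupVN (Measure.count : Measure D)) {T' : Lp ℂ 2 μ →L[ℂ] Lp ℂ 2 μ}
    (hT' : ∀ f g,
      inner ℂ g (T' f) = pairing Measure.count (restrictHom hd (coeffElt μ f g)) T) :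
    T' ∈ groupVN μ := by
  let LD : (D →₀ ℂ) →ₗ[ℂ] (Lp ℂ 2 (Measure.count : Measure D) →WOT[ℂ] Lp ℂ 2 (Measure.count : Measure D)) :=
    Finsupp.linearCombination ℂ fun h => ContinuousLinearMapWOT.ofCLM (leftReg Measure.count h)
  let LG : (D →₀ ℂ) →ₗ[ℂ] (Lp ℂ 2 μ →WOT[ℂ] Lp ℂ 2 μ) :=
    Finsupp.linearCombination ℂ fun h => ContinuousLinearMapWOT.ofCLM (leftReg μ (j h))
  have hLG : ∀ a, LG a ∈ Submodule.span ℂ (Set.range fun x : G =>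
      (ContinuousLinearMapWOT.ofCLM (leftReg μ x) : Lp ℂ 2 μ →WOT[ℂ] Lp ℂ 2 μ)) := fun a => by
    refine Submodule.sum_mem _ fun h _ => Submodule.smul_mem _ _ (Submodule.subset_span ⟨j h, rfl⟩)
  have hcomp : ∀ a {B : Lp ℂ 2 (Measure.count : Measure D) →L[ℂ] Lp ℂ 2 μ}, IsIntertwiner μ j B →
      ∀ ζ, LG a (B ζ) = B (LD a ζ) := by
    intro a B hB ζ
    induction a using Finsupp.induction_linear with
    | zero => simp
    | add a b ha hb => simp [ha, hb]
    | single h c => simp [LG, LD, hB h]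
  have hT : (ContinuousLinearMapWOT.ofCLM T.1) ∈ closure (Set.range LD) := by
    have h1 := T.2
    have h2 : Set.range LD = Submodule.span ℂ (Set.range fun x : D =>
      (ContinuousLinearMapWOT.ofCLM (leftReg Measure.count x) :
        Lp ℂ 2 (Measure.count : Measure D) →WOT[ℂ] Lp ℂ 2 (Measure.count : Measure D))) := by
      rw [← Finsupp.range_linearCombination]
      rfl
    rw [h2]
    exact h1
  -- Coefficient families a in D →₀ ℂ for which `LD a` tends to T form a proper filter; the same
  -- filter serves for `LG`.
  have hne : (Filter.comap LD (𝓝 (ContinuousLinearMapWOT.ofCLM T.1))).NeBot := by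
    rw [Filter.comap_neBot_iff_frequently]
    exact mem_closure_iff_frequently.1 hT
  have htend : Filter.Tendsto LG (Filter.comap LD (𝓝 (ContinuousLinearMapWOT.ofCLM T.1)))
      (𝓝 (ContinuousLinearMapWOT.ofCLM T')) := by
    rw [ContinuousLinearMapWOT.tendsto_iff_forall_inner_apply_tendsto]
    intro f g
    obtain ⟨B, ζ, hB, rfl⟩ := exists_intertwiner μ j hd f
    have h1 := (ContinuousLinearMapWOT.tendsto_iff_forall_inner_apply_tendsto.1
      (Filter.tendsto_comap (f := LD) (x := 𝓝 (ContinuousLinearMapWOT.ofCLM T.1)))) ζ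
        (ContinuousLinearMap.adjoint B g)
    simp only [ContinuousLinearMap.adjoint_inner_left, ← hcomp _ hB] at h1
    have h2 : T' (B ζ) = B (T.1 ζ) := apply_intertwiner_of_pairing hd T hT' hB ζ
    change Filter.Tendsto _ _ (𝓝 (inner ℂ g (T' (B ζ))))
    rw [h2]
    exact h1
  exact mem_closure_of_tendsto htend (Filter.Eventually.of_forall hLG)

/-- Restriction from `A(G)` to `A(D)` is completely bounded. -/
theorem isCompletelyBounded_restrictHom (hd : Dense {g | IsBoundedVector μ j g}) :
    IsCompletelyBounded (fourierMatrixNorm μ)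
      (fourierMatrixNorm (Measure.count : Measure D)) (restrictHom hd) := by
  choose L hL using exists_operator_lift hd
  let Ψ : groupVN (Measure.count : Measure D) → groupVN μ :=
    fun T => ⟨L T, lift_mem_groupVN hd T (hL T)⟩
  refine isCompletelyBounded_of_adjoint _ _ _ Ψ (fun w T => ?_) 1 fun m T => ?_
  · have : pairingLeft Measure.count T ∘ₗ restrictHom hd = pairingLeft μ (Ψ T) := by
      refine fourierAlgebra_hom_ext μ fun f g => ?_
      rw [pairingLeft_apply, pairing_coeffElt]
      exact (hL T f g).symm
    exact LinearMap.congr_fun this w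
  · rw [NNReal.coe_one, one_mul]
    refine ContinuousLinearMap.opNorm_le_bound _ (norm_nonneg _) fun f => ?_
    choose B ζ hB hf using fun l => exists_intertwiner μ j hd (f l)
    have h1 := sum_norm_sq_intertwiner_le hB T ζ
    rw [← sq_le_sq₀ (norm_nonneg _) (by positivity), mul_pow, PiLp.norm_sq_eq_of_L2,
      PiLp.norm_sq_eq_of_L2]
    simp only [hf] at h1
    refine le_trans (le_of_eq ?_) h1
    refine Finset.sum_congr rfl fun k _ => ?_
    congr 2
    rw [vnMatrixOp, matrixOp_apply]
    refine Finset.sum_congr rfl fun l _ => ?_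
    rw [← hf l]
    exact apply_intertwiner_of_pairing hd (T k l) (hL (T k l)) (hB l) (ζ l)

end Restriction

/-! ### Density of the bounded vectors. -/

section BoundedVectors

variable {D G : Type*} [Group D] [MeasurableSpace D] [DiscreteMeasurableSpace D]
  [Group G] [MeasurableSpace G] [MeasurableMul G]
variable (μ : Measure G) [μ.IsMulLeftInvariant] (j : D →* G)

/-- The Gram matrix of the vectors λ(j h)g has entries λ_{g,g}(j(h⁻¹k)). Every row is a translate of
one finitely supported function, so Schur's test applies with its ℓ¹ norm as C. -/
theorem isBoundedVector_of_finite {g : Lp ℂ 2 μ}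
    (hg : {t : D | coeffFn μ g g (j t) ≠ 0}.Finite) : IsBoundedVector μ j g := by
  classical
  let C : ℝ := ∑ t ∈ hg.toFinset, ‖coeffFn μ g g (j t)‖
  obtain ⟨J, hJ⟩ := exists_operator_of_gram (deltaBasis D) (fun h => leftReg μ (j h) g) C (by
    intro h s
    have h1 : ∀ k, inner ℂ (leftReg μ (j h) g) (leftReg μ (j k) g) =
        coeffFn μ g g (j (h⁻¹ * k)) := fun k => by
      rw [inner_leftReg_left, ← leftReg_mul_apply, ← map_inv, ← map_mul]
      rfl
    simp only [h1]
    have h2 : ∑ k ∈ s, ‖coeffFn μ g g (j (h⁻¹ * k))‖ =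
        ∑ t ∈ s.image (fun k => h⁻¹ * k), ‖coeffFn μ g g (j t)‖ := by
      rw [Finset.sum_image fun a _ b _ hab => mul_left_cancel hab]
    rw [h2, ← Finset.sum_filter_ne_zero]
    refine Finset.sum_le_sum_of_subset_of_nonneg (fun t ht => ?_) fun _ _ _ => norm_nonneg _
    simpa using (Finset.mem_filter.1 ht).2)
  exact ⟨J, fun h => by rw [← deltaBasis_apply, hJ]⟩

theorem IsBoundedVector.zero : IsBoundedVector μ j 0 := ⟨0, fun h => by simp⟩

variable {μ j} in
theorem IsBoundedVector.add {f g : Lp ℂ 2 μ} (hf : IsBoundedVector μ j f)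
    (hg : IsBoundedVector μ j g) : IsBoundedVector μ j (f + g) := by
  obtain ⟨J, hJ⟩ := hf
  obtain ⟨K, hK⟩ := hg
  exact ⟨J + K, fun h => by simp [hJ, hK]⟩

variable {μ j} in
theorem IsBoundedVector.smul (c : ℂ) {f : Lp ℂ 2 μ} (hf : IsBoundedVector μ j f) :
    IsBoundedVector μ j (c • f) := by
  obtain ⟨J, hJ⟩ := hf
  exact ⟨c • J, fun h => by simp [hJ]⟩

theorem dense_isBoundedVector_of_injective {D' : Type*} [Group D'] [MeasurableSpace D']
    [DiscreteMeasurableSpace D'] {i : D →* D'} (hi : Function.Injective i) :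
    Dense {g | IsBoundedVector (Measure.count : Measure D') i g} := by
  refine dense_span_delta.mono fun g hg => ?_
  induction hg using Submodule.span_induction with
  | mem g h =>
    obtain ⟨k, rfl⟩ := h
    refine isBoundedVector_of_finite _ _ ((Set.finite_singleton (1 : D)).subset fun t ht => ?_)
    have h1 : inner ℂ (delta k) (leftReg Measure.count (i t) (delta k)) ≠ 0 := ht
    rw [leftReg_delta, inner_delta_left, delta_apply] at h1
    have h2 := Set.mem_singleton_iff.1 (Set.mem_of_indicator_ne_zero h1)
    refine hi ?_
    rw [map_one]
    exact mul_eq_right.1 h2.symm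
  | zero => exact IsBoundedVector.zero _ _
  | add f g _ _ hf hg => exact hf.add hg
  | smul c f _ hf => exact hf.smul c

theorem mem_mul_inv_of_coeffFn_ne_zero {g : Lp ℂ 2 μ} {K : Set G} (hg : ∀ᵐ y ∂μ, y ∉ K → g y = 0)
    {x : G} (hx : coeffFn μ g g x ≠ 0) : x ∈ K * K⁻¹ := by
  by_contra hxK
  refine hx ?_
  rw [coeffFn, L2.inner_def]
  refine integral_eq_zero_of_ae ?_
  have h1 : ∀ᵐ y ∂μ, x⁻¹ * y ∉ K → g (x⁻¹ * y) = 0 :=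
    (measurePreserving_mul_left μ x⁻¹).quasiMeasurePreserving.ae hg
  filter_upwards [hg, h1, coeFn_leftReg μ x g] with y hy hy1 hy2
  rw [hy2, Pi.zero_apply]
  by_cases hyK : y ∈ K
  · rw [hy1 fun hK => hxK ⟨y, hyK, (x⁻¹ * y)⁻¹, Set.inv_mem_inv.2 hK, by simp⟩, inner_zero_right]
  · rw [hy hyK, inner_zero_left]

/-- For compact K the coefficient of 1_K is supported in the compact set KK⁻¹, which j meets at only
finitely many t. Inner regularity makes multiples of such indicators span a dense subspace. -/
theorem dense_isBoundedVector [TopologicalSpace G] [IsTopologicalGroup G] [LocallyCompactSpace G]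
    [T2Space G] [BorelSpace G] [μ.Regular] (hj : Filter.Tendsto j Filter.cofinite (Filter.cocompact G)) :
    Dense {g | IsBoundedVector μ j g} := by
  let S : Submodule ℂ (Lp ℂ 2 μ) :=
    { carrier := {g | IsBoundedVector μ j g}
      zero_mem' := IsBoundedVector.zero μ j
      add_mem' := fun hf hg => hf.add hg
      smul_mem' := fun c _ hf => hf.smul c }
  have hcompact : ∀ (c : ℂ) {K : Set G} (hK : IsCompact K), IsBoundedVector μ j
      (indicatorConstLp 2 hK.measurableSet hK.measure_lt_top.ne c) := by
    intro c K hK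
    refine isBoundedVector_of_finite _ _ ?_
    have h1 : ∀ᶠ t in Filter.cofinite, j t ∈ (K * K⁻¹)ᶜ :=
      hj (hK.mul hK.inv).compl_mem_cocompact
    refine Set.Finite.subset h1 fun t ht hmem => hmem ?_
    exact mem_mul_inv_of_coeffFn_ne_zero μ indicatorConstLp_coeFn_notMem ht
  intro f
  change f ∈ S.topologicalClosure
  induction f using Lp.induction (by simp : (2 : ℝ≥0∞) ≠ ∞) with
  | indicatorConst c hs hμs =>
    rename_i s
    have hex : ∀ n : ℕ, ∃ K ⊆ s, IsCompact K ∧ μ (s \ K) < (n + 1 : ℝ≥0∞)⁻¹ := fun n =>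
      hs.exists_isCompact_sdiff_lt hμs.ne (by simp)
    choose K hKs hK hKμ using hex
    rw [Lp.simpleFunc.coe_indicatorConst]
    refine mem_closure_of_tendsto (f := fun n => indicatorConstLp 2 (hK n).measurableSet
      (hK n).measure_lt_top.ne c) (b := Filter.atTop)
      (tendsto_indicatorConstLp_set (by simp) ?_)
      (Filter.Eventually.of_forall fun n => hcompact c (hK n))
    have h0 : Filter.Tendsto (fun n : ℕ => (n + 1 : ℝ≥0∞)⁻¹) Filter.atTop (𝓝 0) := by
      have := (Filter.tendsto_add_atTop_iff_nat 1).2 ENNReal.tendsto_inv_nat_nhds_zero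
      simpa using this
    refine tendsto_of_tendsto_of_tendsto_of_le_of_le tendsto_const_nhds h0 (fun _ => zero_le)
      fun n => ?_
    rw [symmDiff_of_le (hKs n)]
    exact (hKμ n).le
  | add hf hg _ hf' hg' => exact Submodule.add_mem _ hf' hg'
  | isClosed => exact Submodule.isClosed_topologicalClosure _

end BoundedVectors

/-! ### The extension map A(D) → A(G) by compression with J. -/

section Extension

variable {D G : Type*} [Group D] [MeasurableSpace D] [DiscreteMeasurableSpace D]
  [Group G] [MeasurableSpace G] [MeasurableMul G]
variable {μ : Measure G} [μ.IsMulLeftInvariant] {j : D →* G}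

-- The (k, h) matrix entry of J†λ(x)J is u(k⁻¹xh), where u = λ_{ξ,ξ}. Conjugation invariance turns
-- it into u(hk⁻¹x), which depends only on t = kh⁻¹ and is the coefficient of λ(t).
open ContinuousLinearMap in
theorem compress_leftReg {ξ : Lp ℂ 2 μ} {J : Lp ℂ 2 (Measure.count : Measure D) →L[ℂ] Lp ℂ 2 μ}
    (hJ : ∀ h, J (delta h) = leftReg μ (j h) ξ)
    (hinv : ∀ (h : D) x, coeffFn μ ξ ξ ((j h)⁻¹ * x * j h) = coeffFn μ ξ ξ x)
    (x : G) (F : Finset D) (hF : ∀ t ∉ F, coeffFn μ ξ ξ ((j t)⁻¹ * x) = 0) :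
    adjoint J ∘L leftReg μ x ∘L J =
      ∑ t ∈ F, coeffFn μ ξ ξ ((j t)⁻¹ * x) • leftReg Measure.count t := by
  classical
  refine clm_ext_delta fun h => Lp.ext (Measure.ae_count_iff.2 fun k => ?_)
  rw [← inner_delta_left, ← inner_delta_left, comp_apply, comp_apply, adjoint_inner_right, hJ, hJ,
    inner_leftReg_left, ← leftReg_mul_apply, ← leftReg_mul_apply, sum_apply, inner_sum,
    Finset.sum_eq_single (k * h⁻¹)]
  · have h1 : inner ℂ (delta k) (delta (k * h⁻¹ * h) : Lp ℂ 2 (Measure.count : Measure D)) = 1 := by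
      rw [inner_delta_left, delta_apply]
      simp
    rw [smul_apply, leftReg_delta, inner_smul_right, h1, mul_one]
    refine Eq.trans ?_ (hinv h _)
    simp only [map_mul, map_inv, mul_inv_rev, inv_inv, coeffFn]
    congr 3
    group
  · intro t _ ht
    rw [smul_apply, leftReg_delta, inner_smul_right, inner_delta_left, delta_apply,
      Set.indicator_of_notMem, mul_zero]
    rintro h1
    exact ht (eq_mul_inv_of_mul_eq (Set.mem_singleton_iff.1 h1).symm)
  · intro hk
    rw [hF _ hk, zero_smul, zero_apply, inner_zero_right]

open ContinuousLinearMap in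
theorem compress_mem_groupVN {J : Lp ℂ 2 (Measure.count : Measure D) →L[ℂ] Lp ℂ 2 μ}
    (hJ : ∀ x, adjoint J ∘L leftReg μ x ∘L J ∈ groupVN (Measure.count : Measure D))
    {T : Lp ℂ 2 μ →L[ℂ] Lp ℂ 2 μ} (hT : T ∈ groupVN μ) :
    adjoint J ∘L T ∘L J ∈ groupVN (Measure.count : Measure D) := by
  let L : (Lp ℂ 2 μ →WOT[ℂ] Lp ℂ 2 μ) →ₗ[ℂ]
      (Lp ℂ 2 (Measure.count : Measure D) →WOT[ℂ] Lp ℂ 2 (Measure.count : Measure D)) :=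
    { toFun := fun S => ContinuousLinearMapWOT.ofCLM
        (adjoint J ∘L ContinuousLinearMapWOT.toCLM S ∘L J)
      map_add' := fun S S' => by ext; simp
      map_smul' := fun c S => by ext; simp }
  have hL : Continuous L := by
    refine ContinuousLinearMapWOT.continuous_of_dual_apply_continuous fun f y => ?_
    exact ContinuousLinearMapWOT.continuous_dual_apply (J f) (y ∘L adjoint J)
  have hle : Submodule.span ℂ (Set.range fun x : G =>
      (ContinuousLinearMapWOT.ofCLM (leftReg μ x) : Lp ℂ 2 μ →WOT[ℂ] Lp ℂ 2 μ)) ≤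
      ((Submodule.span ℂ (Set.range fun x : D =>
      (ContinuousLinearMapWOT.ofCLM (leftReg Measure.count x) :
        Lp ℂ 2 (Measure.count : Measure D) →WOT[ℂ]
          Lp ℂ 2 (Measure.count : Measure D)))).topologicalClosure).comap L := by
    rw [Submodule.span_le]
    rintro _ ⟨x, rfl⟩
    exact hJ x
  exact Submodule.topologicalClosure_minimal _ hle
    ((Submodule.isClosed_topologicalClosure _).preimage hL) hT

open ContinuousLinearMap in
theorem norm_vnMatrixOp_compress_le (J : Lp ℂ 2 (Measure.count : Measure D) →L[ℂ] Lp ℂ 2 μ)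
    {m : ℕ} (T : Matrix (Fin m) (Fin m) (groupVN μ))
    (S : Matrix (Fin m) (Fin m) (groupVN (Measure.count : Measure D)))
    (hS : ∀ k l, (S k l).1 = adjoint J ∘L (T k l).1 ∘L J) :
    ‖vnMatrixOp Measure.count S‖ ≤ (‖J‖₊ ^ 2 : ℝ≥0) * ‖vnMatrixOp μ T‖ := by
  refine opNorm_le_bound _ (by positivity) fun f => ?_
  set F : PiLp 2 (fun _ : Fin m => Lp ℂ 2 μ) := WithLp.toLp 2 fun l => J (f l) with hF
  have h1 : ∀ k, vnMatrixOp Measure.count S f k = adjoint J (vnMatrixOp μ T F k) := by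
    intro k
    rw [vnMatrixOp, vnMatrixOp, matrixOp_apply, matrixOp_apply, map_sum]
    refine Finset.sum_congr rfl fun l _ => ?_
    simp only [Matrix.map_apply, hS, hF, comp_apply]
  have hFn : ‖F‖ ≤ ‖J‖ * ‖f‖ := by
    rw [← sq_le_sq₀ (norm_nonneg _) (by positivity), mul_pow, PiLp.norm_sq_eq_of_L2,
      PiLp.norm_sq_eq_of_L2, Finset.mul_sum]
    refine Finset.sum_le_sum fun l _ => ?_
    rw [← mul_pow]
    exact pow_le_pow_left₀ (norm_nonneg _) (J.le_opNorm _) 2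
  have h2 : ‖vnMatrixOp Measure.count S f‖ ≤ ‖J‖ * ‖vnMatrixOp μ T F‖ := by
    rw [← sq_le_sq₀ (norm_nonneg _) (by positivity), mul_pow, PiLp.norm_sq_eq_of_L2,
      PiLp.norm_sq_eq_of_L2, Finset.mul_sum]
    refine Finset.sum_le_sum fun l _ => ?_
    rw [← mul_pow, h1]
    refine pow_le_pow_left₀ (norm_nonneg _) ?_ 2
    exact ((adjoint J).le_opNorm _).trans_eq (by rw [LinearIsometryEquiv.norm_map])
  calc ‖vnMatrixOp Measure.count S f‖ ≤ ‖J‖ * ‖vnMatrixOp μ T F‖ := h2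
    _ ≤ ‖J‖ * (‖vnMatrixOp μ T‖ * (‖J‖ * ‖f‖)) := by
        gcongr
        exact ((vnMatrixOp μ T).le_opNorm _).trans (by gcongr)
    _ = _ := by push_cast; ring

open ContinuousLinearMap in
/-- If `u = λ_{ξ,ξ}` is invariant under conjugation by `D` and finitely supported along `D`, then
`w ↦ ∑_t w(t) (δ_t * u)` is a completely bounded map from `A(D)` to `A(G)`. -/
theorem exists_extensionHom {ξ : Lp ℂ 2 μ} (hξ : IsBoundedVector μ j ξ)
    (hinv : ∀ (h : D) x, coeffFn μ ξ ξ ((j h)⁻¹ * x * j h) = coeffFn μ ξ ξ x)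
    (hfin : ∀ x, {t : D | coeffFn μ ξ ξ ((j t)⁻¹ * x) ≠ 0}.Finite) :
    ∃ Φ : fourierAlgebra (Measure.count : Measure D) →ₗ[ℂ] fourierAlgebra μ,
      IsCompletelyBounded (fourierMatrixNorm Measure.count) (fourierMatrixNorm μ) Φ ∧
      ∀ w x, (Φ w : G → ℂ) x =
        ∑ t ∈ (hfin x).toFinset, coeffFn μ ξ ξ ((j t)⁻¹ * x) * (w : D → ℂ) t := by
  obtain ⟨J, hJ⟩ := hξ
  have hcomp : ∀ x, adjoint J ∘L leftReg μ x ∘L J =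
      ∑ t ∈ (hfin x).toFinset, coeffFn μ ξ ξ ((j t)⁻¹ * x) • leftReg Measure.count t := fun x =>
    compress_leftReg hJ hinv x _ fun t ht => by simpa using ht
  have hmem : ∀ T : groupVN μ, adjoint J ∘L T.1 ∘L J ∈ groupVN (Measure.count : Measure D) :=
    fun T => compress_mem_groupVN (fun x => by
      rw [hcomp]
      exact Submodule.sum_mem _ fun t _ => Submodule.smul_mem _ _ (leftReg_mem_groupVN _ t)) T.2
  let Ψ : groupVN μ → groupVN (Measure.count : Measure D) := fun T => ⟨_, hmem T⟩
  -- Φ₀ w is the function x ↦ ⟨w, J†λ(x)J⟩. It sends λ_{f,g} to λ_{Jf,Jg}, and therefore takes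
  -- values in A(G).
  let Φ₀ : fourierAlgebra (Measure.count : Measure D) →ₗ[ℂ] (G → ℂ) :=
    LinearMap.pi fun x => pairingLeft Measure.count (Ψ (leftRegVN μ x))
  have hΦc : ∀ f g, Φ₀ (coeffElt Measure.count f g) = coeffFn μ (J f) (J g) := fun f g => by
    funext x
    change pairing Measure.count _ _ = _
    rw [pairing_coeffElt]
    exact adjoint_inner_right J _ _
  have hΦ₀ : ∀ w, Φ₀ w ∈ fourierAlgebra μ := fun w => by
    suffices h : (⊤ : Submodule ℂ (fourierAlgebra (Measure.count : Measure D))) ≤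
      (fourierAlgebra μ).comap Φ₀ from h trivial
    rw [← span_coeffElt, Submodule.span_le]
    rintro _ ⟨⟨f, g⟩, rfl⟩
    exact Submodule.subset_span ⟨(J f, J g), (hΦc f g).symm⟩
  refine ⟨Φ₀.codRestrict _ hΦ₀, ?_, fun w x => ?_⟩
  · refine isCompletelyBounded_of_adjoint _ _ _ Ψ (fun w T => ?_) (‖J‖₊ ^ 2) fun m T =>
      norm_vnMatrixOp_compress_le J T _ fun k l => rfl
    have : pairingLeft μ T ∘ₗ Φ₀.codRestrict _ hΦ₀ = pairingLeft Measure.count (Ψ T) := by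
      refine fourierAlgebra_hom_ext _ fun f g => ?_
      have h1 : Φ₀.codRestrict _ hΦ₀ (coeffElt Measure.count f g) = coeffElt μ (J f) (J g) :=
        Subtype.ext (hΦc f g)
      rw [LinearMap.comp_apply, h1, pairingLeft_apply, pairingLeft_apply, pairing_coeffElt,
        pairing_coeffElt]
      exact (adjoint_inner_right J _ _).symm
    exact LinearMap.congr_fun this w
  · change pairing Measure.count w (Ψ (leftRegVN μ x)) = _
    have h1 : Ψ (leftRegVN μ x) =
        ∑ t ∈ (hfin x).toFinset, coeffFn μ ξ ξ ((j t)⁻¹ * x) • leftRegVN Measure.count t := by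
      refine Subtype.ext ((hcomp x).trans ?_)
      simp [leftRegVN]
    have h2 : ∀ (F : Finset D) (c : D → ℂ) (S : D → groupVN (Measure.count : Measure D)),
        pairing Measure.count w (∑ t ∈ F, c t • S t) =
          ∑ t ∈ F, c t * pairing Measure.count w (S t) := fun F c S => by
      refine (map_sum ((predualEquiv (Measure.count : Measure D)).symm w).1 _ _).trans ?_
      exact Finset.sum_congr rfl fun t _ => pairing_smul_right _ _ _ _
    rw [h1, h2]
    exact Finset.sum_congr rfl fun t _ => by rw [pairing_leftRegVN]

end Extension

/-! ### Passing to A_G(E), and the projection onto I_G(E). -/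

section Quotient

variable {G : Type*} [Group G] [MeasurableSpace G] [MeasurableMul G]
variable {μ : Measure G} [μ.IsMulLeftInvariant] {E : Set G}

theorem restrictTo_surjective : Function.Surjective (restrictTo μ E) :=
  LinearMap.submoduleMap_surjective _ _

theorem restrictTo_eq_zero_iff (w : fourierAlgebra μ) :
    restrictTo μ E w = 0 ↔ w ∈ vanishingIdeal μ E := by
  constructor
  · intro h x hx
    exact congrFun (congrArg Subtype.val h) ⟨x, hx⟩
  · intro h
    exact Subtype.ext (funext fun x => h x x.2)

/-- A completely bounded map on `A(G)` that kills `I_G(E)` factors through a completely bounded map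
on `A_G(E)`. -/
theorem exists_factor_restrictTo {Φ : fourierAlgebra μ →ₗ[ℂ] fourierAlgebra μ}
    (hΦ : IsCompletelyBounded (fourierMatrixNorm μ) (fourierMatrixNorm μ) Φ)
    (h0 : ∀ w ∈ vanishingIdeal μ E, Φ w = 0) :
    ∃ Γ : restrictionAlgebra μ E →ₗ[ℂ] fourierAlgebra μ, (∀ w, Γ (restrictTo μ E w) = Φ w) ∧
      IsCompletelyBounded (restrictionMatrixNorm μ E) (fourierMatrixNorm μ) Γ := by
  obtain ⟨σ, hσ⟩ := (restrictTo μ E).exists_rightInverse_of_surjective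
    (LinearMap.range_eq_top.2 restrictTo_surjective)
  have hΓ : ∀ w, (Φ ∘ₗ σ) (restrictTo μ E w) = Φ w := by
    intro w
    have h1 : restrictTo μ E (σ (restrictTo μ E w) - w) = 0 := by
      rw [map_sub, sub_eq_zero]
      exact LinearMap.congr_fun hσ _
    have h2 := h0 _ ((restrictTo_eq_zero_iff _).1 h1)
    rwa [map_sub, sub_eq_zero] at h2
  refine ⟨Φ ∘ₗ σ, hΓ, ?_⟩
  obtain ⟨C, hC⟩ := hΦ
  -- A nonzero finite constant can be divided out, which moves the estimate inside the infimum
  -- defining the quotient norm.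
  refine ⟨C + 1, fun n a => ?_⟩
  have hC0 : ((C + 1 : ℝ≥0) : ℝ≥0∞) ≠ 0 := by
    rw [ENNReal.coe_ne_zero]
    positivity
  rw [mul_comm, ← ENNReal.div_le_iff hC0 ENNReal.coe_ne_top]
  refine le_iInf fun w => le_iInf fun hw => ?_
  rw [ENNReal.div_le_iff hC0 ENNReal.coe_ne_top, mul_comm]
  have h1 : a.map (Φ ∘ₗ σ) = w.map Φ := by
    rw [← hw]
    ext1 p q
    exact hΓ (w p q)
  rw [h1]
  refine (hC n w).trans ?_
  gcongr
  simp

/-- If `Γ` is a completely bounded linear extension map for `A_G(E)`, then `I_G(E)` is completely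
complemented. -/
theorem isCompletelyComplemented_of_extension {Φ : fourierAlgebra μ →ₗ[ℂ] fourierAlgebra μ}
    (hΦ : IsCompletelyBounded (fourierMatrixNorm μ) (fourierMatrixNorm μ) Φ)
    (h0 : ∀ w ∈ vanishingIdeal μ E, Φ w = 0)
    (hE : ∀ w, ∀ x ∈ E, (Φ w : G → ℂ) x = (w : G → ℂ) x) :
    IsCompletelyComplemented μ (vanishingIdeal μ E) := by
  have hmem : ∀ w, w - Φ w ∈ vanishingIdeal μ E := fun w x hx => by
    change (w : G → ℂ) x - (Φ w : G → ℂ) x = 0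
    rw [hE w x hx, sub_self]
  have hid : ∀ w ∈ vanishingIdeal μ E, (LinearMap.id - Φ : fourierAlgebra μ →ₗ[ℂ] _) w = w :=
    fun w hw => by simp [h0 w hw]
  refine ⟨LinearMap.id - Φ, isCompletelyBounded_id_sub μ hΦ, LinearMap.ext fun w =>
    hid _ (hmem w), le_antisymm ?_ fun w hw => ⟨w, hid w hw⟩⟩
  rintro _ ⟨w, rfl⟩
  exact hmem w

end Quotient

/-! ### Normalization and support of the bump function. -/

section BumpFunction

theorem IsBumpNhd.measure_ne_zero {G : Type*} [Group G] [TopologicalSpace G]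
    [MeasurableSpace G] {μ : Measure G} [μ.IsHaarMeasure] {E V : Set G} (hV : IsBumpNhd E V) : μ V ≠ 0 :=
  (Measure.measure_pos_of_mem_nhds μ hV.mem_nhds).ne'

variable {G : Type*} [Group G] [TopologicalSpace G] [IsTopologicalGroup G] [MeasurableSpace G]
  [BorelSpace G]
variable {μ : Measure G} [μ.IsHaarMeasure] {E V : Set G}

theorem bumpFn_one (hV : IsBumpNhd E V) : bumpFn μ hV 1 = 1 := by
  have hne : ‖indicatorConstLp 2 hV.measurableSet (hV.measure_ne_top μ) (1 : ℂ)‖ ≠ 0 := by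
    rw [norm_indicatorConstLp (by simp) (by simp)]
    have : μ.real V ≠ 0 := (measureReal_ne_zero_iff (hV.measure_ne_top μ)).2 hV.measure_ne_zero
    simp only [norm_one, one_mul]
    exact (Real.rpow_pos_of_pos (lt_of_le_of_ne measureReal_nonneg this.symm) _).ne'
  rw [bumpFn, coeffFn, leftReg_one_apply, inner_self_eq_norm_sq_to_K, bumpVector, norm_smul,
    Complex.norm_real, norm_inv, norm_norm, inv_mul_cancel₀ hne]
  simp

theorem mem_of_bumpFn_ne_zero (hV : IsBumpNhd E V) {x : G} (hx : bumpFn μ hV x ≠ 0) :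
    x ∈ V * V := by
  have h1 : x ∈ V * V⁻¹ := by
    refine mem_mul_inv_of_coeffFn_ne_zero μ ?_ hx
    have h2 : ∀ᵐ y ∂μ, y ∉ V → indicatorConstLp 2 hV.measurableSet (hV.measure_ne_top μ) (1 : ℂ) y = 0 :=
      indicatorConstLp_coeFn_notMem
    filter_upwards [h2, Lp.coeFn_smul
      (((‖indicatorConstLp 2 hV.measurableSet (hV.measure_ne_top μ) (1 : ℂ)‖⁻¹ : ℝ) : ℂ))
      (indicatorConstLp 2 hV.measurableSet (hV.measure_ne_top μ) (1 : ℂ))] with y hy hy' hyV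
    rw [bumpVector, hy', Pi.smul_apply, hy hyV, smul_zero]
  rwa [hV.symmetric] at h1

/-- Otherwise h⁻¹g ∈ VV ⊆ U, and g would lie in both hU and gU. -/
theorem bumpFn_inv_mul_eq_zero (hV : IsBumpNhd E V) {h g : G} (hh : h ∈ E) (hg : g ∈ E)
    (hne : h ≠ g) : bumpFn μ hV (h⁻¹ * g) = 0 := by
  by_contra h0
  obtain ⟨U, -, h1U, hVU, hdisj⟩ := hV.separating
  have h1 := hVU (mem_of_bumpFn_ne_zero hV h0)
  have hgh : g ∈ h • U := ⟨h⁻¹ * g, h1, mul_inv_cancel_left h g⟩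
  have hgg : g ∈ g • U := ⟨1, h1U, mul_one g⟩
  exact Set.disjoint_left.1 (hdisj h hh g hg hne) hgh hgg

theorem finite_bumpFn_ne_zero [T2Space G] {D : Type*} [Group D] {j : D →* G}
    (hj : Filter.Tendsto j Filter.cofinite (Filter.cocompact G)) (hV : IsBumpNhd E V) (x : G) :
    {t : D | bumpFn μ hV ((j t)⁻¹ * x) ≠ 0}.Finite := by
  have hK : IsCompact ({x} * (closure V * closure V)⁻¹) :=
    isCompact_singleton.mul (hV.isCompact_closure.mul hV.isCompact_closure).inv
  refine Set.Finite.subset (hj hK.compl_mem_cocompact) fun t ht hmem => hmem ?_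
  have h1 := Set.mul_subset_mul subset_closure subset_closure (mem_of_bumpFn_ne_zero hV ht)
  exact ⟨x, rfl, ((j t)⁻¹ * x)⁻¹, Set.inv_mem_inv.2 h1, by simp⟩

end BumpFunction

/-! ### The extension operator and the complement. -/

section Main

theorem discreteMeasurableSpace_of_discreteTopology {D : Type*} [TopologicalSpace D]
    [DiscreteTopology D] [MeasurableSpace D] [BorelSpace D] : DiscreteMeasurableSpace D :=
  ⟨fun s => (isOpen_discrete s).measurableSet⟩

variable {G : Type*} [Group G] [TopologicalSpace G] [IsTopologicalGroup G]
    [LocallyCompactSpace G] [T2Space G] [MeasurableSpace G] [BorelSpace G]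
    (μ : Measure G) [μ.IsHaarMeasure] [μ.Regular]
    (H : Subgroup G) [DiscreteTopology H]
    (E : Set G)

/-- The map `w ↦ ∑_{h ∈ E} w(h) (δ_h * u)` on `A(G)`. -/
theorem exists_extension_map (hEH : E ⊆ (H : Set G))
    (hE : IsStrongLeinertSet ((fun h : H => (h : G)) ⁻¹' E))
    {V : Set G} (hV : IsBumpNhd E V)
    (hinv : ∀ h ∈ E, convDelta (deltaConv h (bumpFn μ hV)) h = bumpFn μ hV) :
    ∃ Φ : fourierAlgebra μ →ₗ[ℂ] fourierAlgebra μ,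
      IsCompletelyBounded (fourierMatrixNorm μ) (fourierMatrixNorm μ) Φ ∧
      ∀ (w : fourierAlgebra μ) (x : G), HasSum (fun h : E => (w : G → ℂ) h * deltaConv (h : G) (bumpFn μ hV) x)
        ((Φ w : G → ℂ) x) := by
  classical
  have : DiscreteMeasurableSpace H := discreteMeasurableSpace_of_discreteTopology
  -- The elements fixing u under conjugation form a subgroup, so D is a group containing E along
  -- which u is invariant.
  let D : Subgroup H := Subgroup.closure ((fun h : H => (h : G)) ⁻¹' E)
  have : DiscreteMeasurableSpace D := discreteMeasurableSpace_of_discreteTopology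
  have hH : Filter.Tendsto H.subtype Filter.cofinite (Filter.cocompact G) :=
    H.tendsto_coe_cofinite_of_discrete (isDiscrete_iff_discreteTopology.2 inferInstance)
  let j : D →* G := H.subtype.comp D.subtype
  have hj : Filter.Tendsto j Filter.cofinite (Filter.cocompact G) :=
    hH.comp D.subtype_injective.tendsto_cofinite
  have hconj : ∀ (h : D) x, bumpFn μ hV ((j h)⁻¹ * x * j h) = bumpFn μ hV x := by
    rintro ⟨h, hh⟩
    change ∀ x, bumpFn μ hV ((h : G)⁻¹ * x * h) = bumpFn μ hV x
    induction hh using Subgroup.closure_induction with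
    | mem h hh =>
      intro x
      have := congrFun (hinv h hh) x
      simpa [convDelta, deltaConv, mul_assoc] using this
    | one => simp
    | mul a b _ _ ha hb =>
      intro x
      rw [← ha x, ← hb ((a : G)⁻¹ * x * a)]
      congr 1
      simp [mul_assoc]
    | inv a _ ha =>
      intro x
      rw [← ha]
      congr 1
      simp [mul_assoc]
  let v : H → ℂ := Set.indicator ((fun h : H => (h : G)) ⁻¹' E) 1
  obtain ⟨M, hM, hMcb⟩ := hE v
    ⟨1, fun x => by by_cases hx : x ∈ ((fun h : H => (h : G)) ⁻¹' E) <;> simp [v, hx]⟩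
    fun x hx => Set.indicator_of_notMem hx _
  have hd₁ : Dense {g | IsBoundedVector μ H.subtype g} := dense_isBoundedVector μ _ hH
  have hd₂ : Dense {g | IsBoundedVector (Measure.count : Measure H) D.subtype g} :=
    dense_isBoundedVector_of_injective D.subtype_injective
  have hfin := finite_bumpFn_ne_zero (μ := μ) hj hV
  have hξ : IsBoundedVector μ j (bumpVector μ hV) := by
    refine isBoundedVector_of_finite _ _ ?_
    -- `hfin` at x = 1 concerns u(t⁻¹), whereas Schur's test needs u(t).
    have h1 := (hfin 1).preimage (inv_injective (G := D)).injOn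
    refine h1.subset fun t ht => ?_
    simpa [bumpFn] using ht
  obtain ⟨Ext, hExt, hExt'⟩ := exists_extensionHom hξ hconj hfin
  refine ⟨Ext ∘ₗ restrictHom hd₂ ∘ₗ M ∘ₗ restrictHom hd₁,
    hExt.comp ((isCompletelyBounded_restrictHom hd₂).comp
      (hMcb.comp (isCompletelyBounded_restrictHom hd₁))), fun w x => ?_⟩
  let ι : E → D := fun h => ⟨⟨h, hEH h.2⟩, Subgroup.subset_closure h.2⟩
  have hι : Function.Injective ι := fun a b hab =>
    Subtype.ext (congrArg (fun t : D => ((t : H) : G)) hab)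
  have hcoef : ∀ t : D, ((restrictHom hd₂ (M (restrictHom hd₁ w)) :
      fourierAlgebra (Measure.count : Measure D)) : D → ℂ) t = v t * (w : G → ℂ) (j t) := by
    intro t
    rw [restrictHom_apply, hM, restrictHom_apply]
    rfl
  have hsum : HasSum (fun t : D => bumpFn μ hV ((j t)⁻¹ * x) * (v t * (w : G → ℂ) (j t)))
      (∑ t ∈ (hfin x).toFinset, bumpFn μ hV ((j t)⁻¹ * x) * (v t * (w : G → ℂ) (j t))) :=
    hasSum_sum_of_ne_finset_zero fun t ht => by
      have : bumpFn μ hV ((j t)⁻¹ * x) = 0 := by simpa using ht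
      rw [this, zero_mul]
  have hrange : ∀ t ∉ Set.range ι, bumpFn μ hV ((j t)⁻¹ * x) * (v t * (w : G → ℂ) (j t)) = 0 := by
    intro t ht
    have : v t = 0 := Set.indicator_of_notMem (s := (fun h : H => (h : G)) ⁻¹' E)
      (a := t.1) (fun hmem => ht ⟨⟨_, hmem⟩, rfl⟩) _
    rw [this, zero_mul, mul_zero]
  rw [LinearMap.comp_apply, hExt']
  simp only [LinearMap.comp_apply, hcoef]
  have hfun : (fun h : E => (w : G → ℂ) h * deltaConv (h : G) (bumpFn μ hV) x) =
      (fun t : D => bumpFn μ hV ((j t)⁻¹ * x) * (v t * (w : G → ℂ) (j t))) ∘ ι := by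
    funext h
    have hv : v (ι h) = 1 := Set.indicator_of_mem (s := (fun h : H => (h : G)) ⁻¹' E) h.2 _
    rw [Function.comp_apply, hv, one_mul, mul_comm]
    rfl
  rw [hfun]
  exact (hι.hasSum_iff hrange).2 hsum

theorem extension_and_complement_of_bump (hEH : E ⊆ (H : Set G))
    (hE : IsStrongLeinertSet ((fun h : H => (h : G)) ⁻¹' E))
    {V : Set G} (hV : IsBumpNhd E V)
    (hinv : ∀ h ∈ E, convDelta (deltaConv h (bumpFn μ hV)) h = bumpFn μ hV) :
    (∃ Γ : restrictionAlgebra μ E →ₗ[ℂ] fourierAlgebra μ,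
      IsExtensionMap μ E (bumpFn μ hV) Γ ∧
        IsCompletelyBounded (restrictionMatrixNorm μ E) (fourierMatrixNorm μ) Γ) ∧
    IsCompletelyComplemented μ (vanishingIdeal μ E) := by
  obtain ⟨Φ, hΦ, hsum⟩ := exists_extension_map μ H E hEH hE hV hinv
  have h0 : ∀ w ∈ vanishingIdeal μ E, Φ w = 0 := fun w hw => by
    refine Subtype.ext (funext fun x => (hsum w x).unique ?_)
    have : (fun h : E => (w : G → ℂ) h * deltaConv (h : G) (bumpFn μ hV) x) = fun _ => 0 :=
      funext fun h => by rw [hw h h.2, zero_mul]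
    rw [this]
    exact hasSum_zero
  have hext : ∀ w, ∀ x ∈ E, (Φ w : G → ℂ) x = (w : G → ℂ) x := fun w x hx => by
    refine (hsum w x).unique ?_
    have h1 := hasSum_single (f := fun h : E => (w : G → ℂ) h * deltaConv (h : G) (bumpFn μ hV) x)
      ⟨x, hx⟩ fun h hne => by
        rw [deltaConv, bumpFn_inv_mul_eq_zero hV h.2 hx fun h2 => hne (Subtype.ext h2), mul_zero]
    simpa [deltaConv, bumpFn_one] using h1
  obtain ⟨Γ, hΓ, hΓcb⟩ := exists_factor_restrictTo hΦ h0
  refine ⟨⟨Γ, ⟨fun φ x => ?_, fun φ h => ?_⟩, hΓcb⟩,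
    isCompletelyComplemented_of_extension hΦ h0 hext⟩
  · obtain ⟨w, rfl⟩ := restrictTo_surjective φ
    rw [hΓ]
    exact hsum w x
  · obtain ⟨w, rfl⟩ := restrictTo_surjective φ
    rw [hΓ]
    exact hext w h h.2

end Main

/-! ### Conjugation invariant bump functions in [SIN]-groups. -/

section SIN

variable {G : Type*} [Group G] [TopologicalSpace G] [IsTopologicalGroup G]
    [LocallyCompactSpace G] [MeasurableSpace G] [BorelSpace G]
    (μ : Measure G) [μ.IsHaarMeasure] [μ.Regular]

/-- In a `[SIN]`-group there are bump neighbourhoods that are invariant under conjugation. -/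
theorem IsSINGroup.exists_isBumpNhd (hG : IsSINGroup G) (H : Subgroup G) [DiscreteTopology H]
    {E : Set G} (hEH : E ⊆ (H : Set G)) :
    ∃ V : Set G, IsBumpNhd E V ∧ ∀ g x : G, x ∈ V → g * x * g⁻¹ ∈ V := by
  obtain ⟨U₀, hU₀, hU₀H⟩ : ∃ U ∈ 𝓝 (1 : G), ∀ h ∈ H, h ∈ U → h = 1 := by
    have h1 : ({1} : Set H) ∈ 𝓝 (1 : H) := by simp
    rw [nhds_subtype_eq_comap, Filter.mem_comap] at h1
    obtain ⟨U, hU, hU1⟩ := h1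
    exact ⟨U, hU, fun h hh hhU => congrArg Subtype.val (hU1 (a := ⟨h, hh⟩) hhU)⟩
  -- If g₁a = g₂b with a, b ∈ U, then g₁⁻¹g₂ = ab⁻¹ ∈ U₀ ∩ H = {1}; this separates the translates of
  -- U.
  obtain ⟨U, hUo, h1U, hUU⟩ : ∃ U : Set G, IsOpen U ∧ 1 ∈ U ∧ U * U⁻¹ ⊆ U₀ := by
    obtain ⟨U, hU, hUU⟩ := exists_nhds_split_inv hU₀
    refine ⟨interior U, isOpen_interior, mem_interior_iff_mem_nhds.2 hU, ?_⟩
    rintro _ ⟨a, ha, b, hb, rfl⟩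
    simpa using hUU a (interior_subset ha) b⁻¹ (interior_subset hb)
  obtain ⟨W₀, hW₀o, h1W₀, hW₀⟩ := exists_open_nhds_one_mul_subset (hUo.mem_nhds h1U)
  obtain ⟨K, hK, hK1⟩ := exists_compact_mem_nhds (1 : G)
  obtain ⟨W, hW1, hWsub, hWinv⟩ := hG (W₀ ∩ K) (Filter.inter_mem (hW₀o.mem_nhds h1W₀) hK1)
  have hint : ∀ g x : G, x ∈ interior W → g * x * g⁻¹ ∈ interior W := by
    intro g x hx
    have h1 : (fun y => g⁻¹ * y * g) ⁻¹' interior W ⊆ W := fun y hy => by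
      have := hWinv g _ (interior_subset hy)
      simpa [mul_assoc] using this
    refine interior_maximal h1 (isOpen_interior.preimage (by fun_prop)) ?_
    simpa [mul_assoc] using hx
  have hVopen : IsOpen (interior W ∩ (interior W)⁻¹) := isOpen_interior.inter isOpen_interior.inv
  have hVW₀ : interior W ∩ (interior W)⁻¹ ⊆ W₀ := fun x hx => (hWsub (interior_subset hx.1)).1
  refine ⟨interior W ∩ (interior W)⁻¹, ⟨?_, hVopen.measurableSet, ?_, ?_, U, hUo, h1U, ?_, ?_⟩, ?_⟩
  · have h1 : (1 : G) ∈ interior W := mem_interior_iff_mem_nhds.2 hW1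
    exact hVopen.mem_nhds ⟨h1, by simpa using h1⟩
  · exact hK.closure_of_subset fun x hx => (hWsub (interior_subset hx.1)).2
  · rw [Set.inter_inv, inv_inv, Set.inter_comm]
  · exact (Set.mul_subset_mul hVW₀ hVW₀).trans hW₀
  · intro g₁ h₁ g₂ h₂ hne
    rw [Set.disjoint_left]
    rintro _ ⟨a, ha, rfl⟩ ⟨b, hb, hab⟩
    refine hne (inv_mul_eq_one.1 (hU₀H _ (H.mul_mem (H.inv_mem (hEH h₁)) (hEH h₂))
      (hUU ⟨a, ha, b⁻¹, Set.inv_mem_inv.2 hb, ?_⟩)))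
    have hab' : g₂ * b = g₁ * a := hab
    change a * b⁻¹ = g₁⁻¹ * g₂
    rw [mul_inv_eq_iff_eq_mul, mul_assoc, hab', inv_mul_cancel_left]
  · rintro g x ⟨h1, h2⟩
    refine ⟨hint g x h1, ?_⟩
    have := hint g _ h2
    simpa [mul_assoc] using this

/-- A Haar measure is invariant under those right translations that preserve the measure of a set
of finite positive measure. -/
theorem measure_preimage_mul_right_eq {g : G} {V : Set G}
    (h0 : μ V ≠ 0) (htop : μ V ≠ ∞) (hV : μ ((fun x => x * g) ⁻¹' V) = μ V) (A : Set G) :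
    μ ((fun x => x * g) ⁻¹' A) = μ A := by
  have hreg : (μ.map (fun x => x * g)).Regular := Measure.Regular.map (Homeomorph.mulRight g)
  -- Uniqueness of Haar measure: the pushforward is a multiple of μ, and the value on V shows that
  -- the factor is 1.
  have h1 := Measure.isMulLeftInvariant_eq_smul_of_regular (μ.map (fun x => x * g)) μ
  have h2 : ∀ B, μ ((fun x => x * g) ⁻¹' B) =
      Measure.haarScalarFactor (μ.map (fun x => x * g)) μ • μ B := fun B => by
    rw [← Measure.smul_apply, ← h1]
    exact ((Homeomorph.mulRight g).toMeasurableEquiv.map_apply B).symm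
  have h3 : Measure.haarScalarFactor (μ.map (fun x => x * g)) μ = 1 := by
    have h4 := h2 V
    rw [hV, ENNReal.smul_def, smul_eq_mul] at h4
    exact_mod_cast (ENNReal.mul_left_inj h0 htop).1 ((one_mul _).trans h4).symm
  rw [h2, h3, one_smul]

/-- Up to a constant factor u(x) is μ(V ∩ xV). As V is invariant, passing from x to h⁻¹xh conjugates
V ∩ xV by h⁻¹. Conjugation preserves μ: left translation always does, and right translation does
because it leaves μ(V) unchanged. -/
theorem convDelta_deltaConv_bumpFn {E V : Set G} (hV : IsBumpNhd E V)
    (hinv : ∀ g x : G, x ∈ V → g * x * g⁻¹ ∈ V) (h : G) :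
    convDelta (deltaConv h (bumpFn μ hV)) h = bumpFn μ hV := by
  set f := indicatorConstLp 2 hV.measurableSet (hV.measure_ne_top μ) (1 : ℂ) with hf
  have hxV : ∀ x : G, μ ((fun y => x⁻¹ * y) ⁻¹' V) ≠ ∞ := fun x => by
    rw [measure_preimage_mul]
    exact hV.measure_ne_top μ
  have h1 : ∀ x, inner ℂ f (leftReg μ x f) = (μ.real (V ∩ (fun y => x⁻¹ * y) ⁻¹' V) : ℂ) := by
    intro x
    have h2 : leftReg μ x f = indicatorConstLp 2 (measurable_const_mul x⁻¹ hV.measurableSet)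
      (hxV x) (1 : ℂ) := Lp.indicatorConstLp_compMeasurePreserving _ _ _ _
    rw [h2, hf, L2.inner_indicatorConstLp_indicatorConstLp _ _ (hV.measure_ne_top μ) (hxV x)]
    simp
  have hiff : ∀ g x : G, g * x * g⁻¹ ∈ V ↔ x ∈ V := fun g x =>
    ⟨fun h => by simpa [mul_assoc] using hinv g⁻¹ _ h, hinv g x⟩
  have h2 : ∀ x, bumpFn μ hV (h⁻¹ * x * h) = bumpFn μ hV x := by
    intro x
    have h3 : inner ℂ f (leftReg μ (h⁻¹ * x * h) f) = inner ℂ f (leftReg μ x f) := by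
      rw [h1, h1]
      congr 1
      rw [Measure.real, Measure.real]
      congr 1
      have h4 : V ∩ (fun y => (h⁻¹ * x * h)⁻¹ * y) ⁻¹' V =
          (fun y => h * y) ⁻¹' ((fun y => y * h⁻¹) ⁻¹' (V ∩ (fun y => x⁻¹ * y) ⁻¹' V)) := by
        ext y
        simp only [Set.mem_inter_iff, Set.mem_preimage]
        rw [hiff h y, ← hiff h ((h⁻¹ * x * h)⁻¹ * y)]
        simp [mul_assoc]
      rw [h4, measure_preimage_mul]
      refine measure_preimage_mul_right_eq μ hV.measure_ne_zero (hV.measure_ne_top μ) ?_ _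
      rw [← measure_preimage_mul μ h]
      congr 1
      ext y
      exact hiff h y
    simp only [bumpFn, coeffFn, bumpVector, map_smul, inner_smul_left, inner_smul_right]
    rw [h3]
  funext x
  have := h2 x
  rwa [mul_assoc] at this

end SIN

end LeinertFourier

end

open LeinertFourier
theorem proposition3p11 {G : Type*} [Group G] [TopologicalSpace G] [IsTopologicalGroup G]
    [LocallyCompactSpace G] [T2Space G] [MeasurableSpace G] [BorelSpace G]
    (μ : Measure G) [μ.IsHaarMeasure] [μ.Regular]
    (H : Subgroup G) [DiscreteTopology H]
    (E : Set G) (hEH : E ⊆ (H : Set G))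
    (hE : IsStrongLeinertSet ((fun h : H => (h : G)) ⁻¹' E)) :
    (∀ (V : Set G) (hV : IsBumpNhd E V),
      (∀ h ∈ E, convDelta (deltaConv h (bumpFn μ hV)) h = bumpFn μ hV) →
        (∃ Γ : restrictionAlgebra μ E →ₗ[ℂ] fourierAlgebra μ,
          IsExtensionMap μ E (bumpFn μ hV) Γ ∧
            IsCompletelyBounded (restrictionMatrixNorm μ E) (fourierMatrixNorm μ) Γ) ∧
        IsCompletelyComplemented μ (vanishingIdeal μ E)) ∧
    (IsSINGroup G → IsCompletelyComplemented μ (vanishingIdeal μ E)) := by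
  refine ⟨fun V hV hinv => extension_and_complement_of_bump μ H E hEH hE hV hinv, fun hG => ?_⟩
  obtain ⟨V, hV, hinv⟩ := hG.exists_isBumpNhd H hEH
  exact (extension_and_complement_of_bump μ H E hEH hE hV
    fun h _ => convDelta_deltaConv_bumpFn μ hV hinv h).2
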